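/- Let $(\widetilde M, g, J)$ be a Kähler manifold of real dimension $2m$, that is, a smooth Riemannian manifold with Levi-Civita connection $\widetilde\nabla$ and a smooth endomorphism field $J$ with $J^2=-1$, $g(JX,JY)=g(X,Y)$ and $\widetilde\nabla J=0$. Let $M$ be an $n$-dimensional (immersed) submanifold of $\widetilde M$, $n>1$, with the induced metric. For vector fields $X,Y$ on $M$ and normal vector fields $\xi$ write $$\widetilde\nabla_XY=\nabla_XY+\sigma(X,Y),\qquad \widetilde\nabla_X\xi=-A_\xi X+D_X\xi,$$ the decompositions into tangential and normal components; so $\nabla$ is the Levi-Civita connection of $M$, $\sigma$ the second fundamental form and $D$ the normal connection. Let $R$ and $R^\perp$ be the curvature tensors of $\nabla$ and $D$, with the convention $R(X,Y)=\nabla_X\nabla_Y-\nabla_Y\nabla_X-\nabla_{[X,Y]}$ and likewise for $R^\perp$, and let $f\xi$ be the normal component of $J\xi$. Assume that 1. $M$ is totally real: $J(T_pM)\subset (T_pM)^\perp$ for every $p\in M$; 2. $f$ is parallel in the normal bundle (the case $f=0$ being allowed): $D_X(f\xi)=f(D_X\xi)$ for all vector fields $X$ on $M$ and all normal vector fields $\xi$;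 3. $M$ is semiparallel: $R^\perp(X,Y)\sigma(Z,U)-\sigma(R(X,Y)Z,U)-\sigma(Z,R(X,Y)U)=0$ for all vector fields $X,Y,Z,U$ on $M$; 4. $M$ has constant (sectional) curvature $c\in\mathbb R$. Then $c=0$, i.e. $M$ is flat, or $\sigma=0$, i.e. $M$ is a totally geodesic submanifold of $\widetilde M$. -/

import Mathlib

open Bundle Manifold
open scoped Manifold ContDiff

noncomputable section

section Kaehler

variable {E : Type*} [NormedAddCommGroup E] [NormedSpace ℝ E] [FiniteDimensional ℝ E]
  {N : Type*} [TopologicalSpace N] [ChartedSpace E N] [IsManifold 𝓘(ℝ, E) ∞ N]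

/-- `cov` is the Levi-Civita connection of the Riemannian manifold `(N, g)`: the smooth,
torsion-free, metric connection on the tangent bundle (it is unique on smooth vector fields).
Here `cov Y x v` is `∇̃_v Y`. -/
structure IsLeviCivita
    (g : ContMDiffRiemannianMetric 𝓘(ℝ, E) ∞ E (fun x : N => TangentSpace 𝓘(ℝ, E) x))
    (cov : CovariantDerivative 𝓘(ℝ, E) E (fun x : N => TangentSpace 𝓘(ℝ, E) x)) : Prop where
  smooth : cov.ContMDiffCovariantDerivative ∞
  metric : ∀ (Y Z : ∀ x : N, TangentSpace 𝓘(ℝ, E) x) (x : N),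
    MDifferentiableAt 𝓘(ℝ, E) 𝓘(ℝ, E).tangent (fun y => (⟨y, Y y⟩ : TangentBundle 𝓘(ℝ, E) N)) x →
    MDifferentiableAt 𝓘(ℝ, E) 𝓘(ℝ, E).tangent (fun y => (⟨y, Z y⟩ : TangentBundle 𝓘(ℝ, E) N)) x →
    ∀ v : TangentSpace 𝓘(ℝ, E) x,
      mfderiv 𝓘(ℝ, E) 𝓘(ℝ, ℝ) (fun y => g.inner y (Y y) (Z y)) x v =
        g.inner x (cov Y x v) (Z x) + g.inner x (Y x) (cov Z x v)
  torsion_free : cov.torsion = 0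

/-- `(N, g, J)` is a Kähler manifold with Levi-Civita connection `cov`: `J` is a smooth almost
complex structure, orthogonal with respect to the metric `g` and parallel (hence integrable, with
closed fundamental form). -/
structure IsKaehler
    (g : ContMDiffRiemannianMetric 𝓘(ℝ, E) ∞ E (fun x : N => TangentSpace 𝓘(ℝ, E) x))
    (cov : CovariantDerivative 𝓘(ℝ, E) E (fun x : N => TangentSpace 𝓘(ℝ, E) x))
    (J : ∀ x : N, TangentSpace 𝓘(ℝ, E) x →L[ℝ] TangentSpace 𝓘(ℝ, E) x) : Prop where
  leviCivita : IsLeviCivita g cov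
  smooth_J : ContMDiff 𝓘(ℝ, E) (𝓘(ℝ, E).prod 𝓘(ℝ, E →L[ℝ] E)) ∞
    (fun x : N => TotalSpace.mk' (E →L[ℝ] E)
      (E := fun x : N => TangentSpace 𝓘(ℝ, E) x →L[ℝ] TangentSpace 𝓘(ℝ, E) x) x (J x))
  J_sq : ∀ (x : N) (v : TangentSpace 𝓘(ℝ, E) x), J x (J x v) = -v
  J_isometry : ∀ (x : N) (v w : TangentSpace 𝓘(ℝ, E) x),
    g.inner x (J x v) (J x w) = g.inner x v w
  parallel_J : ∀ (Y : ∀ x : N, TangentSpace 𝓘(ℝ, E) x) (x : N),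
    MDifferentiableAt 𝓘(ℝ, E) 𝓘(ℝ, E).tangent (fun y => (⟨y, Y y⟩ : TangentBundle 𝓘(ℝ, E) N)) x →
    ∀ v : TangentSpace 𝓘(ℝ, E) x, cov (fun y => J y (Y y)) x v = J x (cov Y x v)

end Kaehler

namespace Submfd

section Basic

variable {F : Type*} [NormedAddCommGroup F] [NormedSpace ℝ F]
  {M : Type*} [TopologicalSpace M] [ChartedSpace F M]
  {E : Type*} [NormedAddCommGroup E] [NormedSpace ℝ E]
  {N : Type*} [TopologicalSpace N] [ChartedSpace E N]

variable (F E) in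
/-- `ι : M → N` is a smooth immersion, i.e. exhibits `M` as an (immersed) submanifold of `N`. -/
structure IsImmersed (ι : M → N) : Prop where
  smooth : ContMDiff 𝓘(ℝ, F) 𝓘(ℝ, E) ∞ ι
  injective : ∀ p : M, Function.Injective (mfderiv 𝓘(ℝ, F) 𝓘(ℝ, E) ι p)

variable (F E) in
/-- The differential of `ι`, as a map `T_pM → T_{ι p}N`. -/
def dι (ι : M → N) (p : M) : TangentSpace 𝓘(ℝ, F) p →L[ℝ] TangentSpace 𝓘(ℝ, E) (ι p) :=
  mfderiv 𝓘(ℝ, F) 𝓘(ℝ, E) ι p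

/-- Smooth vector fields on `M`. -/
def IsSmoothField [IsManifold 𝓘(ℝ, F) ∞ M] (X : ∀ p : M, TangentSpace 𝓘(ℝ, F) p) : Prop :=
  ContMDiff 𝓘(ℝ, F) 𝓘(ℝ, F).tangent ∞ (fun p => (⟨p, X p⟩ : TangentBundle 𝓘(ℝ, F) M))

variable (F) in
/-- Smooth vector fields of `N` along `ι`, i.e. smooth sections of the pullback of `TN`. -/
def IsSmoothAlong [IsManifold 𝓘(ℝ, E) ∞ N] (ι : M → N)
    (ξ : ∀ p : M, TangentSpace 𝓘(ℝ, E) (ι p)) : Prop :=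
  ContMDiff 𝓘(ℝ, F) 𝓘(ℝ, E).tangent ∞ (fun p => (⟨ι p, ξ p⟩ : TangentBundle 𝓘(ℝ, E) N))

/-- The derivative `∇̃_v s` of a vector field `s` of `N` along `ι` in the direction `v ∈ T_pM`, i.e.
the pullback to `M` of the connection `cov` on `TN`. If `(e_i)` is the coordinate frame of `N`
around `ι p` and `s = ∑ s^i (e_i ∘ ι)`, then it is `∑ ds^i(v) e_i + ∑ s^i(p) ∇̃_{dι v} e_i`;
`FiberBundle.extend` is the extension `∑ s^i(p) e_i` of `s p` with constant coefficients in that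
frame. -/
def covAlong [IsManifold 𝓘(ℝ, E) ∞ N]
    (cov : CovariantDerivative 𝓘(ℝ, E) E (fun x : N => TangentSpace 𝓘(ℝ, E) x))
    (ι : M → N) (s : ∀ p : M, TangentSpace 𝓘(ℝ, E) (ι p)) (p : M) (v : TangentSpace 𝓘(ℝ, F) p) :
    TangentSpace 𝓘(ℝ, E) (ι p) :=
  let e := trivializationAt E (fun x : N => TangentSpace 𝓘(ℝ, E) x) (ι p)
  e.symm (ι p) (mfderiv 𝓘(ℝ, F) 𝓘(ℝ, E) (fun q => (e ⟨ι q, s q⟩).2) p v)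
    + cov (FiberBundle.extend E (s p)) (ι p) (dι F E ι p v)

end Basic

section Metric

variable {F : Type*} [NormedAddCommGroup F] [NormedSpace ℝ F]
  {M : Type*} [TopologicalSpace M] [ChartedSpace F M]
  {E : Type*} [NormedAddCommGroup E] [NormedSpace ℝ E] [FiniteDimensional ℝ E]
  {N : Type*} [TopologicalSpace N] [ChartedSpace E N] [IsManifold 𝓘(ℝ, E) ∞ N]
  (g : ContMDiffRiemannianMetric 𝓘(ℝ, E) ∞ E (fun x : N => TangentSpace 𝓘(ℝ, E) x))
  (cov : CovariantDerivative 𝓘(ℝ, E) E (fun x : N => TangentSpace 𝓘(ℝ, E) x))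
  (J : ∀ x : N, TangentSpace 𝓘(ℝ, E) x →L[ℝ] TangentSpace 𝓘(ℝ, E) x) (ι : M → N)

/-- The induced metric on `M`. -/
def metric (p : M) (v w : TangentSpace 𝓘(ℝ, F) p) : ℝ :=
  g.inner (ι p) (dι F E ι p v) (dι F E ι p w)

/-- Every `w ∈ T_{ι p}N` is the sum of a tangential vector `dι v` and a vector that is orthogonal
to the submanifold. -/
lemma exists_tangentPart (p : M) (w : TangentSpace 𝓘(ℝ, E) (ι p)) :
    ∃ v : TangentSpace 𝓘(ℝ, F) p, ∀ u : TangentSpace 𝓘(ℝ, F) p,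
      g.inner (ι p) (w - dι F E ι p v) (dι F E ι p u) = 0 := by
  have : FiniteDimensional ℝ (TangentSpace 𝓘(ℝ, E) (ι p)) :=
    inferInstanceAs (FiniteDimensional ℝ E)
  let B : LinearMap.BilinForm ℝ (TangentSpace 𝓘(ℝ, E) (ι p)) :=
    LinearMap.mk₂ ℝ (fun a b => g.inner (ι p) a b) (by simp) (by simp) (by simp) (by simp)
  have hB : ∀ a b, B a b = g.inner (ι p) a b := fun _ _ => rfl
  have hrefl : B.IsRefl := fun a b h => by
    rw [hB, g.symm]; exact h
  let W : Submodule ℝ (TangentSpace 𝓘(ℝ, E) (ι p)) := LinearMap.range (dι F E ι p).toLinearMap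
  have hdisj : Disjoint W (B.orthogonal W) := by
    rw [Submodule.disjoint_def]
    intro a ha hao
    by_contra hne
    have h1 : B a a = 0 := hao a ha
    have h2 := g.pos (ι p) a hne
    rw [← hB, h1] at h2
    exact lt_irrefl _ h2
  have hcompl := (LinearMap.BilinForm.isCompl_orthogonal_iff_disjoint hrefl).2 hdisj
  obtain ⟨a, ha, b, hb, hab⟩ := Submodule.mem_sup.1 (hcompl.sup_eq_top ▸ Submodule.mem_top (x := w))
  obtain ⟨v, hv⟩ := ha
  refine ⟨v, fun u => ?_⟩
  have hwb : w - dι F E ι p v = b := by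
    rw [← hab, ← hv]; exact add_sub_cancel_left _ _
  rw [hwb, g.symm]
  exact hb _ ⟨u, rfl⟩

/-- The tangential component of `w ∈ T_{ι p}N`, as a vector of `T_pM` (unique if `ι` is an
immersion). -/
def tangentPart (p : M) (w : TangentSpace 𝓘(ℝ, E) (ι p)) : TangentSpace 𝓘(ℝ, F) p :=
  (exists_tangentPart g ι p w).choose

variable (F) in
/-- The normal component of `w ∈ T_{ι p}N`. -/
def normalPart (p : M) (w : TangentSpace 𝓘(ℝ, E) (ι p)) : TangentSpace 𝓘(ℝ, E) (ι p) :=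
  w - dι F E ι p (tangentPart g ι p w)

variable (F) in
/-- Normal vector fields. -/
def IsNormal (ξ : ∀ p : M, TangentSpace 𝓘(ℝ, E) (ι p)) : Prop :=
  ∀ (p : M) (v : TangentSpace 𝓘(ℝ, F) p), g.inner (ι p) (dι F E ι p v) (ξ p) = 0

variable (F) in
/-- The endomorphism `f` of the normal bundle, `f ξ` being the normal part of `J ξ`. -/
def fOp (ξ : ∀ p : M, TangentSpace 𝓘(ℝ, E) (ι p)) (p : M) : TangentSpace 𝓘(ℝ, E) (ι p) :=
  normalPart F g ι p (J (ι p) (ξ p))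

variable (F) in
/-- `J T_pM ⊆ (T_pM)^⊥` for all `p`. -/
def IsTotallyReal : Prop :=
  ∀ (p : M) (v w : TangentSpace 𝓘(ℝ, F) p),
    g.inner (ι p) (J (ι p) (dι F E ι p v)) (dι F E ι p w) = 0

variable [IsManifold 𝓘(ℝ, F) ∞ M]

/-- The induced connection `∇_X Y` of the submanifold, the tangential part of `∇̃_X Y`. If `cov` is
the Levi-Civita connection of `N`, it is the Levi-Civita connection of the induced metric. -/
def nabla (X Y : ∀ p : M, TangentSpace 𝓘(ℝ, F) p) (p : M) : TangentSpace 𝓘(ℝ, F) p :=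
  tangentPart g ι p (covAlong cov ι (fun q => dι F E ι q (Y q)) p (X p))

/-- The second fundamental form `σ(X, Y)`, the normal part of `∇̃_X Y`. -/
def sff (X Y : ∀ p : M, TangentSpace 𝓘(ℝ, F) p) (p : M) : TangentSpace 𝓘(ℝ, E) (ι p) :=
  normalPart F g ι p (covAlong cov ι (fun q => dι F E ι q (Y q)) p (X p))

/-- The normal connection `D_X ξ`, the normal part of `∇̃_X ξ`. -/
def normalConn (X : ∀ p : M, TangentSpace 𝓘(ℝ, F) p) (ξ : ∀ p : M, TangentSpace 𝓘(ℝ, E) (ι p))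
    (p : M) : TangentSpace 𝓘(ℝ, E) (ι p) :=
  normalPart F g ι p (covAlong cov ι ξ p (X p))

/-- The curvature `R(X, Y)Z = ∇_X ∇_Y Z - ∇_Y ∇_X Z - ∇_[X,Y] Z` of the submanifold. -/
def curv (X Y Z : ∀ p : M, TangentSpace 𝓘(ℝ, F) p) (p : M) : TangentSpace 𝓘(ℝ, F) p :=
  nabla g cov ι X (nabla g cov ι Y Z) p - nabla g cov ι Y (nabla g cov ι X Z) p
    - nabla g cov ι (VectorField.mlieBracket 𝓘(ℝ, F) X Y) Z p

/-- The curvature `R^⊥(X, Y)ξ = D_X D_Y ξ - D_Y D_X ξ - D_[X,Y] ξ` of the normal connection. -/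
def normalCurv (X Y : ∀ p : M, TangentSpace 𝓘(ℝ, F) p)
    (ξ : ∀ p : M, TangentSpace 𝓘(ℝ, E) (ι p)) (p : M) : TangentSpace 𝓘(ℝ, E) (ι p) :=
  normalConn g cov ι X (normalConn g cov ι Y ξ) p - normalConn g cov ι Y (normalConn g cov ι X ξ) p
    - normalConn g cov ι (VectorField.mlieBracket 𝓘(ℝ, F) X Y) ξ p

variable (F)

/-- `D f = 0`, i.e. `D_X (f ξ) = f (D_X ξ)` for all smooth `X` and all smooth normal `ξ`. -/
def HasParallelF : Prop :=
  ∀ (X : ∀ p : M, TangentSpace 𝓘(ℝ, F) p) (ξ : ∀ p : M, TangentSpace 𝓘(ℝ, E) (ι p)),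
    IsSmoothField X → IsSmoothAlong F ι ξ → IsNormal F g ι ξ →
    ∀ p, normalConn g cov ι X (fOp F g J ι ξ) p = fOp F g J ι (normalConn g cov ι X ξ) p

/-- `(R̄(X,Y)·σ)(Z,U) = R^⊥(X,Y)σ(Z,U) - σ(R(X,Y)Z,U) - σ(Z,R(X,Y)U)` vanishes. -/
def IsSemiparallel : Prop :=
  ∀ X Y Z U : ∀ p : M, TangentSpace 𝓘(ℝ, F) p,
    IsSmoothField X → IsSmoothField Y → IsSmoothField Z → IsSmoothField U →
    ∀ p, normalCurv g cov ι X Y (sff g cov ι Z U) p - sff g cov ι (curv g cov ι X Y Z) U p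
      - sff g cov ι Z (curv g cov ι X Y U) p = 0

/-- All sectional curvatures of the induced metric are equal to `c`, that is
`g(R(X,Y)Y,X) = c (g(X,X) g(Y,Y) - g(X,Y)²)`. -/
def HasConstantCurvature (c : ℝ) : Prop :=
  ∀ X Y : ∀ p : M, TangentSpace 𝓘(ℝ, F) p, IsSmoothField X → IsSmoothField Y →
    ∀ p, metric g ι p (curv g cov ι X Y Y p) (X p) =
      c * (metric g ι p (X p) (X p) * metric g ι p (Y p) (Y p) - metric g ι p (X p) (Y p) ^ 2)

/-- `σ = 0`. -/
def IsTotallyGeodesic : Prop :=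
  ∀ X Y : ∀ p : M, TangentSpace 𝓘(ℝ, F) p, IsSmoothField X → IsSmoothField Y →
    ∀ p, sff g cov ι X Y p = 0

end Metric

end Submfd

end

/-! Put C(X,Y,Z) = g(σ(X,Y), JZ). Differentiating g(Y, JZ) = 0 and using that J is parallel shows
that C is totally symmetric (`cubicForm_comm`, `cubicForm_comm_right`). Since f(JY) = 0, parallelism
of f gives 0 = f(D_X(JY)) = f²σ(X,Y), and f is skew, so fσ = 0 (`HasParallelF.fOp_sff`). Hence σ
takes values in J(TM), D_X(JY) = J∇_X Y, and R^⊥(X,Y)JZ = J R(X,Y)Z.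

Semiparallelity now says that R(X,Y), acting as a derivation, annihilates C; for constant curvature
c this is the algebraic identity `IsSemiparallel.cubicForm_eq`. If c ≠ 0, X ⊥ Y and Y ≠ 0 at p, two
substitutions give 3|Y|²C(Y,Y,X) = 0 and |Y|²C(X,X,X) = 2|X|²C(X,Y,Y). Such a Y exists because n >
1, so C vanishes on the diagonal and, by polarization, everywhere. Finally σ(X,Y) = JW with |W|² =
C(X,Y,W) = 0.

The remaining work is submanifold calculus. The connection along ι is metric, torsion free and
commutes with J; therefore ∇ is torsion free and metric, and R has the symmetries that determine it
from its sectional curvatures (`HasConstantCurvature.curv_eq`). Tensoriality of R and σ is never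
needed: forms evaluated at p are treated as functions on the additive group of smooth fields, with
additivity in the last slot carried to the others by symmetry. -/

noncomputable section

/-! ### The Lie bracket as a commutator of derivations. -/

section Commutator

open VectorField Filter
open scoped Topology

variable {F : Type*} [NormedAddCommGroup F] [NormedSpace ℝ F]
  {M : Type*} [TopologicalSpace M] [ChartedSpace F M]
  {G : Type*} [NormedAddCommGroup G] [NormedSpace ℝ G]

lemma Filter.EventuallyEq.mvfderiv_eq {f h : M → G} {p : M} (hfh : f =ᶠ[𝓝 p] h) :
    mvfderiv 𝓘(ℝ, F) f p = mvfderiv 𝓘(ℝ, F) h p := by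
  ext v
  exact congrArg (fun L : F →L[ℝ] G => L v) hfh.mfderiv_eq

variable [IsManifold 𝓘(ℝ, F) ∞ M]

/-- The derivative of a function along a vector field is one order less smooth than the function. -/
lemma ContMDiffAt.mvfderiv_apply {n m : ℕ∞ω} {f : M → G}
    {X : ∀ p : M, TangentSpace 𝓘(ℝ, F) p} {p : M}
    (hf : ContMDiffAt 𝓘(ℝ, F) 𝓘(ℝ, G) n f p)
    (hX : ContMDiffAt 𝓘(ℝ, F) 𝓘(ℝ, F).tangent m
      (fun q => (⟨q, X q⟩ : TangentBundle 𝓘(ℝ, F) M)) p) (hmn : m + 1 ≤ n) :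
    ContMDiffAt 𝓘(ℝ, F) 𝓘(ℝ, G) m (fun q => mvfderiv 𝓘(ℝ, F) f q (X q)) p := by
  have h1 := hf.mfderiv_const hmn
  have h2 : ContMDiffAt 𝓘(ℝ, F) (𝓘(ℝ, G).prod 𝓘(ℝ, G)) m
      (fun q => (TotalSpace.mk' G (f q) (mfderiv 𝓘(ℝ, F) 𝓘(ℝ, G) f q (X q)) :
        TangentBundle 𝓘(ℝ, G) G)) p :=
    ContMDiffAt.clm_apply_of_inCoordinates h1 hX (hf.of_le (le_trans le_self_add hmn))
  exact (contMDiff_snd_tangentBundle_modelSpace (𝕜 := ℝ) G 𝓘(ℝ, G)).contMDiffAt.comp p h2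

variable [FiniteDimensional ℝ F] in
-- Expand the Jacobi identity for X, Y, fZ by the Leibniz rule and use the Jacobi identity for X, Y,
-- Z. The terms with one derivative of f multiplying [X,Z] or [Y,Z] cancel, and what is left is the
-- desired difference times Z, where Z(p) ≠ 0.
lemma mvfderiv_mvfderiv_sub_real {X Y : ∀ p : M, TangentSpace 𝓘(ℝ, F) p} {f : M → ℝ} {p : M}
    (hX : ContMDiffAt 𝓘(ℝ, F) 𝓘(ℝ, F).tangent 2
      (fun q => (⟨q, X q⟩ : TangentBundle 𝓘(ℝ, F) M)) p)
    (hY : ContMDiffAt 𝓘(ℝ, F) 𝓘(ℝ, F).tangent 2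
      (fun q => (⟨q, Y q⟩ : TangentBundle 𝓘(ℝ, F) M)) p)
    (hf : ContMDiffAt 𝓘(ℝ, F) 𝓘(ℝ, ℝ) 2 f p) :
    mvfderiv 𝓘(ℝ, F) (fun q => mvfderiv 𝓘(ℝ, F) f q (Y q)) p (X p)
      - mvfderiv 𝓘(ℝ, F) (fun q => mvfderiv 𝓘(ℝ, F) f q (X q)) p (Y p)
      = mvfderiv 𝓘(ℝ, F) f p (mlieBracket 𝓘(ℝ, F) X Y p) := by
  have : CompleteSpace F := FiniteDimensional.complete ℝ F
  have : IsManifold 𝓘(ℝ, F) (minSmoothness ℝ 3) M := by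
    rw [minSmoothness_of_isRCLikeNormedField]; infer_instance
  have : IsManifold 𝓘(ℝ, F) 3 M := inferInstance
  have : IsManifold 𝓘(ℝ, F) ((2 : ℕ∞) + 1) M := by norm_num; infer_instance
  -- In dimension zero there is no field Z with Z(p) ≠ 0, but then every tangent vector vanishes.
  by_cases hT : ∃ z : F, z ≠ 0
  swap
  · have h0 : ∀ v : TangentSpace 𝓘(ℝ, F) p, v = 0 := fun v => by
      by_contra hv
      exact hT ⟨v, hv⟩
    rw [h0 (X p), h0 (Y p), h0 (mlieBracket 𝓘(ℝ, F) X Y p)]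
    simp only [map_zero, sub_zero]
  obtain ⟨z, hz⟩ := hT
  let Z : ∀ q : M, TangentSpace 𝓘(ℝ, F) q :=
    FiberBundle.extend F (E := fun q : M => TangentSpace 𝓘(ℝ, F) q) (x := p) z
  have hZp : Z p = z :=
    FiberBundle.extend_apply_self F (E := fun q : M => TangentSpace 𝓘(ℝ, F) q) (x := p) z
  have hZ : ContMDiffAt 𝓘(ℝ, F) 𝓘(ℝ, F).tangent 2
      (fun q => (⟨q, Z q⟩ : TangentBundle 𝓘(ℝ, F) M)) p :=
    FiberBundle.contMDiffAt_extend 𝓘(ℝ, F) F (V := fun q : M => TangentSpace 𝓘(ℝ, F) q) (x := p) z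
  have md : ∀ {W : ∀ q : M, TangentSpace 𝓘(ℝ, F) q}, ContMDiffAt 𝓘(ℝ, F) 𝓘(ℝ, F).tangent 2
      (fun q => (⟨q, W q⟩ : TangentBundle 𝓘(ℝ, F) M)) p →
      MDifferentiableAt 𝓘(ℝ, F) 𝓘(ℝ, F).tangent
      (fun q => (⟨q, W q⟩ : TangentBundle 𝓘(ℝ, F) M)) p := fun h => h.mdifferentiableAt (by simp)
  have fd : MDifferentiableAt 𝓘(ℝ, F) 𝓘(ℝ, ℝ) f p := hf.mdifferentiableAt (by simp)
  have hfev : ∀ᶠ q in 𝓝 p, MDifferentiableAt 𝓘(ℝ, F) 𝓘(ℝ, ℝ) f q := by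
    filter_upwards [(contMDiffAt_iff_contMDiffAt_nhds (by simp)).1 hf] with q hq
    exact hq.mdifferentiableAt (by simp)
  have hZev : ∀ᶠ q in 𝓝 p, MDifferentiableAt 𝓘(ℝ, F) 𝓘(ℝ, F).tangent
      (fun q => (⟨q, Z q⟩ : TangentBundle 𝓘(ℝ, F) M)) q := by
    filter_upwards [(contMDiffAt_iff_contMDiffAt_nhds (by simp)).1 hZ] with q hq
    exact hq.mdifferentiableAt (by simp)
  have expand : ∀ {V W : ∀ q : M, TangentSpace 𝓘(ℝ, F) q},
      ContMDiffAt 𝓘(ℝ, F) 𝓘(ℝ, F).tangent 2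
        (fun q => (⟨q, V q⟩ : TangentBundle 𝓘(ℝ, F) M)) p →
      ContMDiffAt 𝓘(ℝ, F) 𝓘(ℝ, F).tangent 2
        (fun q => (⟨q, W q⟩ : TangentBundle 𝓘(ℝ, F) M)) p →
      mlieBracket 𝓘(ℝ, F) V (mlieBracket 𝓘(ℝ, F) W (f • Z)) p =
        mvfderiv 𝓘(ℝ, F) (fun q => mvfderiv 𝓘(ℝ, F) f q (W q)) p (V p) • Z p
        + mvfderiv 𝓘(ℝ, F) f p (W p) • mlieBracket 𝓘(ℝ, F) V Z p
        + mvfderiv 𝓘(ℝ, F) f p (V p) • mlieBracket 𝓘(ℝ, F) W Z p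
        + f p • mlieBracket 𝓘(ℝ, F) V (mlieBracket 𝓘(ℝ, F) W Z) p := by
    intro V W hV hW
    have hb : mlieBracket 𝓘(ℝ, F) W (f • Z) =ᶠ[𝓝 p]
        (fun q => mvfderiv 𝓘(ℝ, F) f q (W q)) • Z + f • mlieBracket 𝓘(ℝ, F) W Z := by
      filter_upwards [hfev, hZev] with q hq hq'
      rw [mlieBracket_smul_right hq hq']
      rfl
    have d1 : MDifferentiableAt 𝓘(ℝ, F) 𝓘(ℝ, ℝ) (fun q => mvfderiv 𝓘(ℝ, F) f q (W q)) p :=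
      (hf.mvfderiv_apply (m := 1) (hW.of_le (by norm_num)) (by norm_num)).mdifferentiableAt
        (by simp)
    have d2 : MDifferentiableAt 𝓘(ℝ, F) 𝓘(ℝ, F).tangent
        (fun q => (⟨q, mlieBracket 𝓘(ℝ, F) W Z q⟩ : TangentBundle 𝓘(ℝ, F) M)) p :=
      (ContMDiffAt.mlieBracket_vectorField (m := 1) (n := 2) hW hZ (by
        rw [minSmoothness_of_isRCLikeNormedField]; norm_num)).mdifferentiableAt (by simp)
    rw [(EventuallyEq.refl (𝓝 p) V).mlieBracket_vectorField_eq hb,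
      mlieBracket_add_right (d1.smul_section (md hZ)) (fd.smul_section d2),
      mlieBracket_smul_right d1 (md hZ), mlieBracket_smul_right fd d2]
    module
  have jac := leibniz_identity_mlieBracket_apply (I := 𝓘(ℝ, F)) (x := p)
    (U := X) (V := Y) (W := f • Z)
    (by rw [minSmoothness_of_isRCLikeNormedField]; exact hX)
    (by rw [minSmoothness_of_isRCLikeNormedField]; exact hY)
    (by rw [minSmoothness_of_isRCLikeNormedField]; exact hf.smul_section hZ)
  have jac' := leibniz_identity_mlieBracket_apply (I := 𝓘(ℝ, F)) (x := p) (U := X) (V := Y) (W := Z)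
    (by rw [minSmoothness_of_isRCLikeNormedField]; exact hX)
    (by rw [minSmoothness_of_isRCLikeNormedField]; exact hY)
    (by rw [minSmoothness_of_isRCLikeNormedField]; exact hZ)
  rw [expand hX hY, expand hY hX, mlieBracket_smul_right fd (md hZ), jac'] at jac
  have hfin : (mvfderiv 𝓘(ℝ, F) (fun q => mvfderiv 𝓘(ℝ, F) f q (Y q)) p (X p)
      - mvfderiv 𝓘(ℝ, F) (fun q => mvfderiv 𝓘(ℝ, F) f q (X q)) p (Y p)
      - mvfderiv 𝓘(ℝ, F) f p (mlieBracket 𝓘(ℝ, F) X Y p)) • Z p = 0 := by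
    rw [← sub_eq_zero] at jac
    rw [← jac]
    module
  rcases smul_eq_zero.1 hfin with h | h
  · exact sub_eq_zero.1 h
  · exact absurd (hZp.symm.trans h) hz

variable [FiniteDimensional ℝ F]

/-- The Lie bracket is the commutator of the derivations given by the two vector fields. -/
lemma mvfderiv_mvfderiv_sub {X Y : ∀ p : M, TangentSpace 𝓘(ℝ, F) p} {h : M → G} {p : M}
    (hX : ContMDiffAt 𝓘(ℝ, F) 𝓘(ℝ, F).tangent 2
      (fun q => (⟨q, X q⟩ : TangentBundle 𝓘(ℝ, F) M)) p)
    (hY : ContMDiffAt 𝓘(ℝ, F) 𝓘(ℝ, F).tangent 2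
      (fun q => (⟨q, Y q⟩ : TangentBundle 𝓘(ℝ, F) M)) p)
    (hh : ContMDiffAt 𝓘(ℝ, F) 𝓘(ℝ, G) 2 h p) :
    mvfderiv 𝓘(ℝ, F) (fun q => mvfderiv 𝓘(ℝ, F) h q (Y q)) p (X p)
      - mvfderiv 𝓘(ℝ, F) (fun q => mvfderiv 𝓘(ℝ, F) h q (X q)) p (Y p)
      = mvfderiv 𝓘(ℝ, F) h p (mlieBracket 𝓘(ℝ, F) X Y p) := by
  have hcl : ∀ (ℓ : G →L[ℝ] ℝ) (k : M → G) (q : M) (v : TangentSpace 𝓘(ℝ, F) q),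
      MDifferentiableAt 𝓘(ℝ, F) 𝓘(ℝ, G) k q →
      ℓ (mvfderiv 𝓘(ℝ, F) k q v) = mvfderiv 𝓘(ℝ, F) (fun r => ℓ (k r)) q v := by
    intro ℓ k q v hk
    have h1 := mfderiv_comp_apply q (ℓ.mdifferentiableAt (x := k q)) hk v
    rw [ℓ.mfderiv_eq] at h1
    exact h1.symm
  have hev : ∀ᶠ q in 𝓝 p, MDifferentiableAt 𝓘(ℝ, F) 𝓘(ℝ, G) h q := by
    filter_upwards [(contMDiffAt_iff_contMDiffAt_nhds (by simp)).1 hh] with q hq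
    exact hq.mdifferentiableAt (by simp)
  -- Continuous functionals separate points of G, which reduces the claim to real-valued functions.
  refine (SeparatingDual.eq_iff_forall_dual_eq (R := ℝ)).2 fun ℓ => ?_
  have key := mvfderiv_mvfderiv_sub_real hX hY
    (f := fun r => ℓ (h r)) ((ℓ.contMDiff (n := 2)).contMDiffAt.comp p hh)
  have hD : ∀ Z : ∀ p : M, TangentSpace 𝓘(ℝ, F) p,
      ContMDiffAt 𝓘(ℝ, F) 𝓘(ℝ, F).tangent 2 (fun q => (⟨q, Z q⟩ : TangentBundle 𝓘(ℝ, F) M)) p →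
      ∀ v, ℓ (mvfderiv 𝓘(ℝ, F) (fun q => mvfderiv 𝓘(ℝ, F) h q (Z q)) p v)
        = mvfderiv 𝓘(ℝ, F) (fun q => mvfderiv 𝓘(ℝ, F) (fun r => ℓ (h r)) q (Z q)) p v := by
    intro Z hZ v
    rw [hcl _ _ _ _ ((hh.mvfderiv_apply (m := 1) (hZ.of_le (by norm_num))
      (by norm_num)).mdifferentiableAt (by simp))]
    have : (fun r => ℓ (mvfderiv 𝓘(ℝ, F) h r (Z r))) =ᶠ[𝓝 p]
        fun q => mvfderiv 𝓘(ℝ, F) (fun r => ℓ (h r)) q (Z q) := by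
      filter_upwards [hev] with q hq
      exact hcl _ _ _ _ hq
    rw [this.mvfderiv_eq]
  rw [map_sub, hD X hX, hD Y hY, key, hcl _ _ _ _ hev.self_of_nhds]

end Commutator


namespace Submfd

open Filter
open scoped Topology

/-! ### Smooth vector fields along a map, and local frames made of global fields. -/

section Along

variable {F : Type*} [NormedAddCommGroup F] [NormedSpace ℝ F]
  {M : Type*} [TopologicalSpace M] [ChartedSpace F M]
  {E : Type*} [NormedAddCommGroup E] [NormedSpace ℝ E]
  {N : Type*} [TopologicalSpace N] [ChartedSpace E N] [IsManifold 𝓘(ℝ, E) ∞ N]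
  {ι : M → N} {s t : ∀ p : M, TangentSpace 𝓘(ℝ, E) (ι p)} {n : ℕ∞ω} {p : M}

lemma eventually_mem_baseSet (hι : ContinuousAt ι p) :
    ∀ᶠ q in 𝓝 p, ι q ∈ (trivializationAt E (fun x : N => TangentSpace 𝓘(ℝ, E) x) (ι p)).baseSet :=
  hι.eventually
    ((trivializationAt E (fun x : N => TangentSpace 𝓘(ℝ, E) x) (ι p)).open_baseSet.mem_nhds
    (FiberBundle.mem_baseSet_trivializationAt' (ι p)))

lemma contMDiffAt_along_iff :
    ContMDiffAt 𝓘(ℝ, F) 𝓘(ℝ, E).tangent n (fun p => (⟨ι p, s p⟩ : TangentBundle 𝓘(ℝ, E) N)) p ↔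
      ContMDiffAt 𝓘(ℝ, F) 𝓘(ℝ, E) n ι p ∧
        ContMDiffAt 𝓘(ℝ, F) 𝓘(ℝ, E) n (fun q =>
          (trivializationAt E (fun x : N => TangentSpace 𝓘(ℝ, E) x) (ι p) ⟨ι q, s q⟩).2) p :=
  contMDiffAt_totalSpace

lemma trivializationAt_add {x y : N}
    (hy : y ∈ (trivializationAt E (fun x : N => TangentSpace 𝓘(ℝ, E) x) x).baseSet)
    (v w : TangentSpace 𝓘(ℝ, E) y) :
    (trivializationAt E (fun x : N => TangentSpace 𝓘(ℝ, E) x) x ⟨y, v + w⟩).2 =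
      (trivializationAt E (fun x : N => TangentSpace 𝓘(ℝ, E) x) x ⟨y, v⟩).2 +
      (trivializationAt E (fun x : N => TangentSpace 𝓘(ℝ, E) x) x ⟨y, w⟩).2 :=
  ((trivializationAt E (fun x : N => TangentSpace 𝓘(ℝ, E) x) x).linear ℝ hy).map_add v w

lemma trivializationAt_smul {x y : N}
    (hy : y ∈ (trivializationAt E (fun x : N => TangentSpace 𝓘(ℝ, E) x) x).baseSet)
    (a : ℝ) (v : TangentSpace 𝓘(ℝ, E) y) :
    (trivializationAt E (fun x : N => TangentSpace 𝓘(ℝ, E) x) x ⟨y, a • v⟩).2 =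
      a • (trivializationAt E (fun x : N => TangentSpace 𝓘(ℝ, E) x) x ⟨y, v⟩).2 :=
  ((trivializationAt E (fun x : N => TangentSpace 𝓘(ℝ, E) x) x).linear ℝ hy).map_smul a v

lemma contMDiffAt_along_add
    (hs : ContMDiffAt 𝓘(ℝ, F) 𝓘(ℝ, E).tangent n
      (fun p => (⟨ι p, s p⟩ : TangentBundle 𝓘(ℝ, E) N)) p)
    (ht : ContMDiffAt 𝓘(ℝ, F) 𝓘(ℝ, E).tangent n
      (fun p => (⟨ι p, t p⟩ : TangentBundle 𝓘(ℝ, E) N)) p) :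
    ContMDiffAt 𝓘(ℝ, F) 𝓘(ℝ, E).tangent n
      (fun p => (⟨ι p, s p + t p⟩ : TangentBundle 𝓘(ℝ, E) N)) p := by
  rw [contMDiffAt_along_iff] at hs ht ⊢
  refine ⟨hs.1, (hs.2.add ht.2).congr_of_eventuallyEq ?_⟩
  filter_upwards [eventually_mem_baseSet (E := E) hs.1.continuousAt] with q hq
  exact trivializationAt_add hq _ _

lemma contMDiffAt_along_smul {a : M → ℝ} (ha : ContMDiffAt 𝓘(ℝ, F) 𝓘(ℝ, ℝ) n a p)
    (hs : ContMDiffAt 𝓘(ℝ, F) 𝓘(ℝ, E).tangent n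
      (fun p => (⟨ι p, s p⟩ : TangentBundle 𝓘(ℝ, E) N)) p) :
    ContMDiffAt 𝓘(ℝ, F) 𝓘(ℝ, E).tangent n
      (fun p => (⟨ι p, a p • s p⟩ : TangentBundle 𝓘(ℝ, E) N)) p := by
  rw [contMDiffAt_along_iff] at hs ⊢
  refine ⟨hs.1, (ha.smul hs.2).congr_of_eventuallyEq ?_⟩
  filter_upwards [eventually_mem_baseSet (E := E) hs.1.continuousAt] with q hq
  exact trivializationAt_smul hq _ _

lemma contMDiffAt_along_zero (hι : ContMDiffAt 𝓘(ℝ, F) 𝓘(ℝ, E) n ι p) :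
    ContMDiffAt 𝓘(ℝ, F) 𝓘(ℝ, E).tangent n
      (fun p => (⟨ι p, 0⟩ : TangentBundle 𝓘(ℝ, E) N)) p := by
  rw [contMDiffAt_along_iff (s := fun _ => 0)]
  refine ⟨hι, (contMDiffAt_const (c := (0 : E))).congr_of_eventuallyEq ?_⟩
  filter_upwards [eventually_mem_baseSet (E := E) hι.continuousAt] with q hq
  exact ((trivializationAt E (fun x : N => TangentSpace 𝓘(ℝ, E) x) (ι p)).linear ℝ hq).map_zero

lemma contMDiffAt_along_sum {κ : Type*} (T : Finset κ) {S : κ → ∀ p : M, TangentSpace 𝓘(ℝ, E) (ι p)}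
    (hι : ContMDiffAt 𝓘(ℝ, F) 𝓘(ℝ, E) n ι p)
    (hS : ∀ i ∈ T, ContMDiffAt 𝓘(ℝ, F) 𝓘(ℝ, E).tangent n
      (fun p => (⟨ι p, S i p⟩ : TangentBundle 𝓘(ℝ, E) N)) p) :
    ContMDiffAt 𝓘(ℝ, F) 𝓘(ℝ, E).tangent n
      (fun p => (⟨ι p, ∑ i ∈ T, S i p⟩ : TangentBundle 𝓘(ℝ, E) N)) p := by
  classical
  induction T using Finset.induction_on with
  | empty => simpa using! contMDiffAt_along_zero hι
  | insert i T hi ih =>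
    simp only [Finset.sum_insert hi]
    exact contMDiffAt_along_add (hS i (Finset.mem_insert_self _ _))
      (ih fun j hj => hS j (Finset.mem_insert_of_mem hj))

lemma contMDiffAt_along_congr
    (hs : ContMDiffAt 𝓘(ℝ, F) 𝓘(ℝ, E).tangent n
      (fun p => (⟨ι p, s p⟩ : TangentBundle 𝓘(ℝ, E) N)) p)
    (hst : ∀ᶠ q in 𝓝 p, t q = s q) :
    ContMDiffAt 𝓘(ℝ, F) 𝓘(ℝ, E).tangent n
      (fun p => (⟨ι p, t p⟩ : TangentBundle 𝓘(ℝ, E) N)) p := by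
  refine hs.congr_of_eventuallyEq ?_
  filter_upwards [hst] with q hq
  rw [hq]

lemma IsSmoothAlong.contMDiff (hs : IsSmoothAlong F ι s) : ContMDiff 𝓘(ℝ, F) 𝓘(ℝ, E) ∞ ι :=
  fun p => (contMDiffAt_along_iff.1 (hs p)).1

lemma IsSmoothAlong.add (hs : IsSmoothAlong F ι s) (ht : IsSmoothAlong F ι t) :
    IsSmoothAlong F ι (fun q => s q + t q) :=
  fun p => contMDiffAt_along_add (hs p) (ht p)

lemma IsSmoothAlong.smul {a : M → ℝ} (ha : ContMDiff 𝓘(ℝ, F) 𝓘(ℝ, ℝ) ∞ a)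
    (hs : IsSmoothAlong F ι s) : IsSmoothAlong F ι (fun q => a q • s q) :=
  fun p => contMDiffAt_along_smul (ha p) (hs p)

lemma IsSmoothAlong.neg (hs : IsSmoothAlong F ι s) : IsSmoothAlong F ι (fun q => - s q) := by
  simpa using IsSmoothAlong.smul (contMDiff_const (c := (-1 : ℝ))) hs

lemma IsSmoothAlong.sub (hs : IsSmoothAlong F ι s) (ht : IsSmoothAlong F ι t) :
    IsSmoothAlong F ι (fun q => s q - t q) := by
  simpa only [sub_eq_add_neg] using hs.add ht.neg

lemma IsSmoothField.along {Y : ∀ x : N, TangentSpace 𝓘(ℝ, E) x} (hY : IsSmoothField Y)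
    (hι : ContMDiff 𝓘(ℝ, F) 𝓘(ℝ, E) ∞ ι) : IsSmoothAlong F ι (fun q => Y (ι q)) :=
  ContMDiff.comp hY hι

variable [FiniteDimensional ℝ E] [T2Space N]

variable (F M) in
/-- Around every point there is a frame consisting of global smooth vector fields, in which all
smooth vector fields along a map have smooth coefficients. -/
lemma exists_smooth_frame (x : N) :
    ∃ e : Fin (Module.finrank ℝ E) → ∀ y : N, TangentSpace 𝓘(ℝ, E) y,
      (∀ i, IsSmoothField (e i)) ∧ (∀ᶠ y in 𝓝 x, ∃ b : Module.Basis (Fin (Module.finrank ℝ E)) ℝ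
        (TangentSpace 𝓘(ℝ, E) y), ∀ i, b i = e i y) ∧
      ∀ (ι : M → N) (s : ∀ p : M, TangentSpace 𝓘(ℝ, E) (ι p)), IsSmoothAlong F ι s →
        ∃ a : Fin (Module.finrank ℝ E) → M → ℝ, (∀ i, ContMDiff 𝓘(ℝ, F) 𝓘(ℝ, ℝ) ∞ (a i)) ∧
          ∀ p, ι p = x → ∀ᶠ q in 𝓝 p, s q = ∑ i, a i q • e i (ι q) := by
  let tr := trivializationAt E (fun x : N => TangentSpace 𝓘(ℝ, E) x) x
  let b := Module.finBasis ℝ E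
  let ψ : SmoothBumpFunction 𝓘(ℝ, E) x := Classical.arbitrary _
  have hsupp : tsupport ψ ⊆ tr.baseSet := ψ.tsupport_subset_chartAt_source
  have hx : x ∈ tr.baseSet := FiberBundle.mem_baseSet_trivializationAt' x
  have h1 : ∀ᶠ y in 𝓝 x, ψ y = 1 ∧ y ∈ tr.baseSet :=
    ψ.eventuallyEq_one.and (tr.open_baseSet.mem_nhds hx)
  -- The bump function ψ extends the coordinate frame by zero to all of N. The coefficients get
  -- their own factor ψ ∘ ι to be globally smooth; both factors equal 1 near x, so the local
  -- expansion is unchanged.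
  refine ⟨fun i y => ψ y • tr.localFrame b i y, fun i => ?_, ?_, fun ι s hs => ?_⟩
  · exact ContMDiffOn.smul_section_of_tsupport ψ.contMDiff.contMDiffOn tr.open_baseSet hsupp
      (tr.contMDiffOn_localFrame_baseSet ∞ b i)
  · filter_upwards [h1] with y ⟨hy, hy'⟩
    exact ⟨tr.basisAt b hy', fun i => by
      rw [hy, one_smul, tr.localFrame_apply_of_mem_baseSet b hy']⟩
  · refine ⟨fun i q => ψ (ι q) * b.repr (tr ⟨ι q, s q⟩).2 i, fun i q => ?_, fun p hp => ?_⟩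
    · have hι := hs.contMDiff
      by_cases hq : ι q ∈ tsupport ψ
      · have h2 : ContMDiffAt 𝓘(ℝ, F) 𝓘(ℝ, E) ∞ (fun q => (tr ⟨ι q, s q⟩).2) q :=
          ((tr.contMDiffAt_iff (f := fun q => (⟨ι q, s q⟩ : TangentBundle 𝓘(ℝ, E) N))
            ((tr.mem_source).2 (hsupp hq))).1 (hs q)).2
        have h3 : ContMDiffAt 𝓘(ℝ, E) 𝓘(ℝ, ℝ) ∞
            (LinearMap.toContinuousLinearMap (b.coord i)) (tr ⟨ι q, s q⟩).2 :=
          (LinearMap.toContinuousLinearMap (b.coord i)).contMDiff.contMDiffAt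
        exact (ψ.contMDiff.contMDiffAt.comp q (hι q)).mul (h3.comp q h2)
      · refine (contMDiffAt_const (c := (0 : ℝ))).congr_of_eventuallyEq ?_
        filter_upwards [(hι q).continuousAt.eventually
          ((isClosed_tsupport ψ).isOpen_compl.mem_nhds hq)] with r hr
        rw [image_eq_zero_of_notMem_tsupport hr, zero_mul]
    · subst hp
      filter_upwards [(hs.contMDiff p).continuousAt.eventually h1] with q ⟨hq, hq'⟩
      conv_lhs => rw [← (tr.basisAt b hq').sum_repr (s q)]
      refine Finset.sum_congr rfl fun i _ => ?_
      rw [hq, one_mul, one_smul, tr.localFrame_apply_of_mem_baseSet b hq']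
      simp [Trivialization.basisAt]

/-- Every tangent vector is the value of a global smooth vector field. -/
lemma exists_isSmoothField_eq (x : N) (v : TangentSpace 𝓘(ℝ, E) x) :
    ∃ Y : ∀ y : N, TangentSpace 𝓘(ℝ, E) y, IsSmoothField Y ∧ Y x = v := by
  obtain ⟨e, he, hb, -⟩ := exists_smooth_frame E N (E := E) x
  obtain ⟨b, hb⟩ := hb.self_of_nhds
  refine ⟨fun y => ∑ i, b.repr v i • e i y, ?_, ?_⟩
  · exact ContMDiff.sum_section fun i _ => ContMDiff.const_smul_section (he i)
  · simp_rw [← hb, b.sum_repr]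

end Along

end Submfd


namespace Submfd

open Filter
open scoped Topology

/-! ### The pulled-back connection: Leibniz rule, locality and expression in a frame. -/

section CovAlong

variable {F : Type*} [NormedAddCommGroup F] [NormedSpace ℝ F]
  {M : Type*} [TopologicalSpace M] [ChartedSpace F M]
  {E : Type*} [NormedAddCommGroup E] [NormedSpace ℝ E]
  {N : Type*} [TopologicalSpace N] [ChartedSpace E N] [IsManifold 𝓘(ℝ, E) ∞ N]
  {cov : CovariantDerivative 𝓘(ℝ, E) E (fun x : N => TangentSpace 𝓘(ℝ, E) x)}
  {ι : M → N} {s t : ∀ p : M, TangentSpace 𝓘(ℝ, E) (ι p)} {p : M}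

lemma eventually_mem_baseSet_self (x : N) :
    ∀ᶠ y in 𝓝 x, y ∈ (trivializationAt E (fun x : N => TangentSpace 𝓘(ℝ, E) x) x).baseSet :=
  eventually_mem_baseSet (ι := (id : N → N)) (p := x) continuousAt_id

/-- The coordinates of a tangent vector at a point `y` near `x` in the chart around `x`. -/
def coord (x y : N) (v : TangentSpace 𝓘(ℝ, E) y) : E :=
  (trivializationAt E (fun x : N => TangentSpace 𝓘(ℝ, E) x) x ⟨y, v⟩).2

/-- The tangent vector at `y` with given coordinates in the chart around `x`. -/
def uncoord (x y : N) : E →L[ℝ] TangentSpace 𝓘(ℝ, E) y :=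
  (trivializationAt E (fun x : N => TangentSpace 𝓘(ℝ, E) x) x).symmL ℝ y

lemma uncoord_apply {x y : N}
    (hy : y ∈ (trivializationAt E (fun x : N => TangentSpace 𝓘(ℝ, E) x) x).baseSet) (v : E) :
    uncoord x y v = (trivializationAt E (fun x : N => TangentSpace 𝓘(ℝ, E) x) x).symm y v :=
  Trivialization.symmL_apply _ hy v

lemma covAlong_eq (s : ∀ p : M, TangentSpace 𝓘(ℝ, E) (ι p)) (p : M) (v : TangentSpace 𝓘(ℝ, F) p) :
    covAlong cov ι s p v =
      uncoord (ι p) (ι p) (mvfderiv 𝓘(ℝ, F) (fun q => coord (ι p) (ι q) (s q)) p v)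
        + cov (FiberBundle.extend E (s p)) (ι p) (dι F E ι p v) := by
  rw [uncoord_apply (FiberBundle.mem_baseSet_trivializationAt' _)]
  rfl

lemma uncoord_coord {x y : N}
    (hy : y ∈ (trivializationAt E (fun x : N => TangentSpace 𝓘(ℝ, E) x) x).baseSet)
    (v : TangentSpace 𝓘(ℝ, E) y) : uncoord x y (coord x y v) = v := by
  rw [uncoord_apply hy]
  exact Trivialization.symm_proj_apply _ (⟨y, v⟩ : TangentBundle 𝓘(ℝ, E) N) hy

lemma coord_uncoord {x y : N}
    (hy : y ∈ (trivializationAt E (fun x : N => TangentSpace 𝓘(ℝ, E) x) x).baseSet)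
    (v : E) : coord x y (uncoord x y v) = v := by
  rw [uncoord_apply hy]
  exact congrArg Prod.snd
    ((trivializationAt E (fun x : N => TangentSpace 𝓘(ℝ, E) x) x).apply_mk_symm hy v)

lemma uncoord_coord_self (x : N) (v : TangentSpace 𝓘(ℝ, E) x) : uncoord x x (coord x x v) = v :=
  uncoord_coord (FiberBundle.mem_baseSet_trivializationAt' x) v

lemma extend_eq {x y : N}
    (hy : y ∈ (trivializationAt E (fun x : N => TangentSpace 𝓘(ℝ, E) x) x).baseSet)
    (v : TangentSpace 𝓘(ℝ, E) x) : FiberBundle.extend E v y = uncoord x y (coord x x v) := by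
  rw [uncoord_apply hy]
  rfl

lemma covAlong_congr (h : ∀ᶠ q in 𝓝 p, s q = t q) (v : TangentSpace 𝓘(ℝ, F) p) :
    covAlong cov ι s p v = covAlong cov ι t p v := by
  have : (fun q => coord (ι p) (ι q) (s q)) =ᶠ[𝓝 p] fun q => coord (ι p) (ι q) (t q) := by
    filter_upwards [h] with q hq
    rw [hq]
  rw [covAlong_eq, covAlong_eq, this.mvfderiv_eq, h.self_of_nhds]

lemma coord_add {x y : N}
    (hy : y ∈ (trivializationAt E (fun x : N => TangentSpace 𝓘(ℝ, E) x) x).baseSet)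
    (v w : TangentSpace 𝓘(ℝ, E) y) : coord x y (v + w) = coord x y v + coord x y w :=
  trivializationAt_add hy v w

lemma coord_smul {x y : N}
    (hy : y ∈ (trivializationAt E (fun x : N => TangentSpace 𝓘(ℝ, E) x) x).baseSet)
    (a : ℝ) (v : TangentSpace 𝓘(ℝ, E) y) : coord x y (a • v) = a • coord x y v :=
  trivializationAt_smul hy a v

lemma IsSmoothAlong.coord (hs : IsSmoothAlong F ι s) (p : M) :
    ContMDiffAt 𝓘(ℝ, F) 𝓘(ℝ, E) ∞ (fun q => coord (ι p) (ι q) (s q)) p :=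
  (contMDiffAt_along_iff.1 (hs p)).2

/-- Together with `cov_extend_smul` this is the linearity of the Christoffel term in `covAlong`: an
extension with constant coordinates depends linearly on its value at x. -/
lemma cov_extend_add {x : N} (v w : TangentSpace 𝓘(ℝ, E) x) :
    cov (FiberBundle.extend E (v + w)) x =
      cov (FiberBundle.extend E v) x + cov (FiberBundle.extend E w) x := by
  have hv := FiberBundle.mdifferentiableAt_extend 𝓘(ℝ, E) E v
  have hw := FiberBundle.mdifferentiableAt_extend 𝓘(ℝ, E) E w
  rw [← cov.isCovariantDerivativeOnUniv.add hv hw]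
  refine cov.isCovariantDerivativeOnUniv.congr_of_eventuallyEq
    (FiberBundle.mdifferentiableAt_extend ..) (mdifferentiableAt_add_section hv hw) univ_mem ?_
  filter_upwards [eventually_mem_baseSet_self (E := E) x] with y hy
  rw [Pi.add_apply, extend_eq hy, extend_eq hy, extend_eq hy,
    coord_add (FiberBundle.mem_baseSet_trivializationAt' x), map_add]

lemma cov_extend_smul {x : N} (a : ℝ) (v : TangentSpace 𝓘(ℝ, E) x) :
    cov (FiberBundle.extend E (a • v)) x = a • cov (FiberBundle.extend E v) x := by
  have hv := FiberBundle.mdifferentiableAt_extend 𝓘(ℝ, E) E v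
  rw [← cov.isCovariantDerivativeOnUniv.smul_const a hv]
  refine cov.isCovariantDerivativeOnUniv.congr_of_eventuallyEq
    (FiberBundle.mdifferentiableAt_extend ..) (mdifferentiableAt_const.smul_section hv) univ_mem ?_
  filter_upwards [eventually_mem_baseSet_self (E := E) x] with y hy
  rw [Pi.smul_apply, extend_eq hy, extend_eq hy,
    coord_smul (FiberBundle.mem_baseSet_trivializationAt' x), map_smul]

lemma covAlong_add (hs : IsSmoothAlong F ι s) (ht : IsSmoothAlong F ι t)
    (v : TangentSpace 𝓘(ℝ, F) p) :
    covAlong cov ι (fun q => s q + t q) p v = covAlong cov ι s p v + covAlong cov ι t p v := by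
  have h1 : (fun q => coord (ι p) (ι q) (s q + t q)) =ᶠ[𝓝 p]
      (fun q => coord (ι p) (ι q) (s q)) + fun q => coord (ι p) (ι q) (t q) := by
    filter_upwards [eventually_mem_baseSet (E := E) (hs.contMDiff p).continuousAt] with q hq
    exact coord_add hq _ _
  rw [covAlong_eq, covAlong_eq, covAlong_eq, h1.mvfderiv_eq,
    mvfderiv_add ((hs.coord p).mdifferentiableAt (by simp))
      ((ht.coord p).mdifferentiableAt (by simp)), cov_extend_add]
  simp only [add_apply, map_add]
  abel

lemma covAlong_smul {a : M → ℝ} (ha : ContMDiff 𝓘(ℝ, F) 𝓘(ℝ, ℝ) ∞ a) (hs : IsSmoothAlong F ι s)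
    (v : TangentSpace 𝓘(ℝ, F) p) :
    covAlong cov ι (fun q => a q • s q) p v =
      mvfderiv 𝓘(ℝ, F) a p v • s p + a p • covAlong cov ι s p v := by
  have h1 : (fun q => coord (ι p) (ι q) (a q • s q)) =ᶠ[𝓝 p]
      a • (fun q => coord (ι p) (ι q) (s q)) := by
    filter_upwards [eventually_mem_baseSet (E := E) (hs.contMDiff p).continuousAt] with q hq
    exact coord_smul hq _ _
  rw [covAlong_eq, covAlong_eq, h1.mvfderiv_eq,
    mvfderiv_smul ((ha p).mdifferentiableAt (by simp)) ((hs.coord p).mdifferentiableAt (by simp)),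
    cov_extend_smul]
  simp only [add_apply, map_add, smul_apply, map_smul,
    ContinuousLinearMap.smulRight_apply, uncoord_coord_self, smul_add]
  abel

lemma covAlong_zero (hι : ContMDiff 𝓘(ℝ, F) 𝓘(ℝ, E) ∞ ι) (v : TangentSpace 𝓘(ℝ, F) p) :
    covAlong cov ι (fun _ => 0) p v = 0 := by
  have h0 : IsSmoothAlong F ι (fun _ => (0 : TangentSpace 𝓘(ℝ, E) _)) :=
    fun p => contMDiffAt_along_zero (hι p)
  have := covAlong_add (cov := cov) (p := p) h0 h0 v
  simpa using this

lemma covAlong_sum {κ : Type*} (T : Finset κ) {S : κ → ∀ p : M, TangentSpace 𝓘(ℝ, E) (ι p)}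
    (hι : ContMDiff 𝓘(ℝ, F) 𝓘(ℝ, E) ∞ ι) (hS : ∀ i, IsSmoothAlong F ι (S i))
    (v : TangentSpace 𝓘(ℝ, F) p) :
    covAlong cov ι (fun q => ∑ i ∈ T, S i q) p v = ∑ i ∈ T, covAlong cov ι (S i) p v := by
  classical
  induction T using Finset.induction_on with
  | empty => simpa using covAlong_zero hι v
  | insert i T hi ih =>
    simp only [Finset.sum_insert hi]
    rw [covAlong_add (hS i) (fun p => contMDiffAt_along_sum T (hι p) fun j _ => hS j p), ih]

variable [FiniteDimensional ℝ E]

/-- The covariant derivative minus the coordinate derivative is tensorial, so Y may be replaced by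
the extension of Y(x), whose coordinates are constant. This is what makes `covAlong` agree with
`cov` on restrictions of fields of N. -/
lemma cov_eq_extend {Y : ∀ x : N, TangentSpace 𝓘(ℝ, E) x} {x : N}
    (hY : MDifferentiableAt 𝓘(ℝ, E) 𝓘(ℝ, E).tangent
      (fun y => (⟨y, Y y⟩ : TangentBundle 𝓘(ℝ, E) N)) x) (w : TangentSpace 𝓘(ℝ, E) x) :
    cov Y x w = uncoord x x (mvfderiv 𝓘(ℝ, E) (fun y => coord x y (Y y)) x w)
      + cov (FiberBundle.extend E (Y x)) x w := by
  have hc : ∀ {Z : ∀ x : N, TangentSpace 𝓘(ℝ, E) x}, MDifferentiableAt 𝓘(ℝ, E) 𝓘(ℝ, E).tangent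
      (fun y => (⟨y, Z y⟩ : TangentBundle 𝓘(ℝ, E) N)) x →
      MDifferentiableAt 𝓘(ℝ, E) 𝓘(ℝ, E) (fun y => coord x y (Z y)) x := fun hZ =>
    ((trivializationAt E (fun x : N => TangentSpace 𝓘(ℝ, E) x) x).mdifferentiableAt_section_iff
      𝓘(ℝ, E) _ (FiberBundle.mem_baseSet_trivializationAt' x)).1 hZ
  have hmem := eventually_mem_baseSet_self (E := E) x
  have hΦ : TensorialAt 𝓘(ℝ, E) E (fun Z : ∀ x : N, TangentSpace 𝓘(ℝ, E) x =>
      cov Z x w - uncoord x x (mvfderiv 𝓘(ℝ, E) (fun y => coord x y (Z y)) x w)) x := by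
    constructor
    · intro f Z hf hZ
      have h1 : (fun y => coord x y ((f • Z) y)) =ᶠ[𝓝 x] f • fun y => coord x y (Z y) := by
        filter_upwards [hmem] with y hy
        exact coord_smul hy _ _
      rw [h1.mvfderiv_eq, mvfderiv_smul hf (hc hZ), cov.isCovariantDerivativeOnUniv.leibniz hZ hf]
      simp only [add_apply, map_add, smul_apply, map_smul,
        ContinuousLinearMap.smulRight_apply, uncoord_coord_self, smul_sub]
      abel
    · intro Z Z' hZ hZ'
      have h1 : (fun y => coord x y ((Z + Z') y)) =ᶠ[𝓝 x]
          (fun y => coord x y (Z y)) + fun y => coord x y (Z' y) := by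
        filter_upwards [hmem] with y hy
        exact coord_add hy _ _
      rw [h1.mvfderiv_eq, mvfderiv_add (hc hZ) (hc hZ'), cov.isCovariantDerivativeOnUniv.add hZ hZ']
      simp only [add_apply, map_add]
      abel
  have h2 := hΦ.pointwise hY (FiberBundle.mdifferentiableAt_extend 𝓘(ℝ, E) E (Y x))
    (FiberBundle.extend_apply_self E (Y x)).symm
  have h3 : (fun y => coord x y (FiberBundle.extend E (Y x) y)) =ᶠ[𝓝 x]
      fun _ => coord x x (Y x) := by
    filter_upwards [hmem] with y hy
    rw [extend_eq hy]
    exact coord_uncoord hy _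
  simp only [h3.mvfderiv_eq, mvfderiv_const, zero_apply, map_zero,
    sub_zero] at h2
  rw [← h2]
  abel

lemma covAlong_comp {Y : ∀ x : N, TangentSpace 𝓘(ℝ, E) x} (hY : IsSmoothField Y)
    (hι : ContMDiff 𝓘(ℝ, F) 𝓘(ℝ, E) ∞ ι) (v : TangentSpace 𝓘(ℝ, F) p) :
    covAlong cov ι (fun q => Y (ι q)) p v = cov Y (ι p) (dι F E ι p v) := by
  rw [covAlong_eq, cov_eq_extend ((hY (ι p)).mdifferentiableAt (by simp))]
  have h1 : MDifferentiableAt 𝓘(ℝ, E) 𝓘(ℝ, E) (fun y => coord (ι p) y (Y y)) (ι p) :=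
    (IsSmoothAlong.coord (ι := id) hY (ι p)).mdifferentiableAt (by simp)
  have h2 := mfderiv_comp_apply p h1 ((hι p).mdifferentiableAt (by simp)) v
  congr 2

/-- The derivative along `ι` in terms of a smooth frame. -/
lemma covAlong_eq_sum {κ : Type*} [Fintype κ] {e : κ → ∀ x : N, TangentSpace 𝓘(ℝ, E) x}
    (he : ∀ i, IsSmoothField (e i)) {a : κ → M → ℝ}
    (ha : ∀ i, ContMDiff 𝓘(ℝ, F) 𝓘(ℝ, ℝ) ∞ (a i)) (hι : ContMDiff 𝓘(ℝ, F) 𝓘(ℝ, E) ∞ ι)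
    (hs : ∀ᶠ q in 𝓝 p, s q = ∑ i, a i q • e i (ι q)) (v : TangentSpace 𝓘(ℝ, F) p) :
    covAlong cov ι s p v = ∑ i, (mvfderiv 𝓘(ℝ, F) (a i) p v • e i (ι p)
      + a i p • cov (e i) (ι p) (dι F E ι p v)) := by
  rw [covAlong_congr hs, covAlong_sum _ hι fun i => ((he i).along hι).smul (ha i)]
  refine Finset.sum_congr rfl fun i _ => ?_
  rw [covAlong_smul (ha i) ((he i).along hι), covAlong_comp (he i) hι]

end CovAlong

end Submfd


namespace Submfd

open Filter
open scoped Topology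

/-! ### Compatibility of the pulled-back connection with J, the metric and the bracket. -/

section LeviCivita

variable {F : Type*} [NormedAddCommGroup F] [NormedSpace ℝ F]
  {M : Type*} [TopologicalSpace M] [ChartedSpace F M]
  {E : Type*} [NormedAddCommGroup E] [NormedSpace ℝ E]
  {N : Type*} [TopologicalSpace N] [ChartedSpace E N] [IsManifold 𝓘(ℝ, E) ∞ N]
  {g : ContMDiffRiemannianMetric 𝓘(ℝ, E) ∞ E (fun x : N => TangentSpace 𝓘(ℝ, E) x)}
  {cov : CovariantDerivative 𝓘(ℝ, E) E (fun x : N => TangentSpace 𝓘(ℝ, E) x)}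
  {J : ∀ x : N, TangentSpace 𝓘(ℝ, E) x →L[ℝ] TangentSpace 𝓘(ℝ, E) x}
  {ι : M → N} {s t : ∀ p : M, TangentSpace 𝓘(ℝ, E) (ι p)} {p : M}

lemma IsSmoothAlong.inner (hs : IsSmoothAlong F ι s) (ht : IsSmoothAlong F ι t) :
    ContMDiff 𝓘(ℝ, F) 𝓘(ℝ, ℝ) ∞ (fun q => g.inner (ι q) (s q) (t q)) := by
  have h1 := ContMDiff.clm_bundle_apply₂ (F₁ := E) (F₂ := E) (F₃ := ℝ) (E₃ := Bundle.Trivial N ℝ)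
    (g.contMDiff.comp hs.contMDiff) hs ht
  intro q
  exact (contMDiffAt_totalSpace.1 (h1 q)).2

lemma IsSmoothAlong.apply_J (hJ : ContMDiff 𝓘(ℝ, E) (𝓘(ℝ, E).prod 𝓘(ℝ, E →L[ℝ] E)) ∞
    (fun x : N => TotalSpace.mk' (E →L[ℝ] E)
      (E := fun x : N => TangentSpace 𝓘(ℝ, E) x →L[ℝ] TangentSpace 𝓘(ℝ, E) x) x (J x)))
    (hs : IsSmoothAlong F ι s) : IsSmoothAlong F ι (fun q => J (ι q) (s q)) :=
  ContMDiff.clm_bundle_apply (F₁ := E) (F₂ := E) (hJ.comp hs.contMDiff) hs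

lemma mvfderiv_inner_along_sum
    (g : ContMDiffRiemannianMetric 𝓘(ℝ, E) ∞ E (fun x : N => TangentSpace 𝓘(ℝ, E) x))
    {κ : Type*} (T : Finset κ) {S : κ → ∀ p : M, TangentSpace 𝓘(ℝ, E) (ι p)}
    (hS : ∀ i, IsSmoothAlong F ι (S i)) (ht : IsSmoothAlong F ι t) (v : TangentSpace 𝓘(ℝ, F) p) :
    mvfderiv 𝓘(ℝ, F) (fun q => g.inner (ι q) (∑ i ∈ T, S i q) (t q)) p v =
      ∑ i ∈ T, mvfderiv 𝓘(ℝ, F) (fun q => g.inner (ι q) (S i q) (t q)) p v := by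
  classical
  induction T using Finset.induction_on with
  | empty => simp [mvfderiv_const]
  | insert i T hi ih =>
    simp only [Finset.sum_insert hi, map_add, add_apply]
    rw [mvfderiv_fun_add (((hS i).inner ht p).mdifferentiableAt (by simp)), add_apply, ih]
    exact ((IsSmoothAlong.inner (s := fun q => ∑ i ∈ T, S i q)
      (fun p => contMDiffAt_along_sum T (ht.contMDiff p) fun j _ => hS j p) ht)
        p).mdifferentiableAt (by simp)

section Frame

variable [FiniteDimensional ℝ E] [T2Space N]

lemma covAlong_J (hK : IsKaehler g cov J) (hs : IsSmoothAlong F ι s)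
    (v : TangentSpace 𝓘(ℝ, F) p) :
    Submfd.covAlong cov ι (fun q => J (ι q) (s q)) p v = J (ι p) (Submfd.covAlong cov ι s p v) := by
  have hι := hs.contMDiff
  obtain ⟨e, he, -, hexp⟩ := exists_smooth_frame F M (E := E) (ι p)
  obtain ⟨a, ha, hsa⟩ := hexp ι s hs
  have hJe : ∀ i, IsSmoothField (fun y => J y (e i y)) := fun i =>
    IsSmoothAlong.apply_J (ι := id) hK.smooth_J (he i)
  have h1 : ∀ᶠ q in 𝓝 p, J (ι q) (s q) = ∑ i, a i q • J (ι q) (e i (ι q)) := by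
    filter_upwards [hsa p rfl] with q hq
    rw [hq, map_sum]
    simp only [map_smul]
  rw [covAlong_eq_sum he ha hι (hsa p rfl), covAlong_eq_sum hJe ha hι h1, map_sum]
  refine Finset.sum_congr rfl fun i _ => ?_
  rw [hK.parallel_J (e i) _ ((he i (ι p)).mdifferentiableAt (by simp)), map_add, map_smul, map_smul]

/-- The connection along `ι` is metric. -/
lemma mvfderiv_inner_along (hLC : IsLeviCivita g cov) (hs : IsSmoothAlong F ι s)
    (ht : IsSmoothAlong F ι t) (v : TangentSpace 𝓘(ℝ, F) p) :
    mvfderiv 𝓘(ℝ, F) (fun q => g.inner (ι q) (s q) (t q)) p v =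
      g.inner (ι p) (Submfd.covAlong cov ι s p v) (t p)
        + g.inner (ι p) (s p) (Submfd.covAlong cov ι t p v) := by
  have hι := hs.contMDiff
  obtain ⟨e, he, -, hexp⟩ := exists_smooth_frame F M (E := E) (ι p)
  obtain ⟨a, ha, hsa⟩ := hexp ι s hs
  obtain ⟨b, hb, htb⟩ := hexp ι t ht
  have hS : ∀ i, IsSmoothAlong F ι (fun q => a i q • e i (ι q)) :=
    fun i => ((he i).along hι).smul (ha i)
  have hT : ∀ i, IsSmoothAlong F ι (fun q => b i q • e i (ι q)) :=
    fun i => ((he i).along hι).smul (hb i)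
  have hTs : IsSmoothAlong F ι (fun q => ∑ j, b j q • e j (ι q)) :=
    fun p => contMDiffAt_along_sum _ (hι p) fun j _ => hT j p
  -- The factors stand in the order j, i because `mvfderiv_inner_along_sum` expands the first slot
  -- only: the sum over j is moved there by `hflip`.
  have hterm : ∀ i j, mvfderiv 𝓘(ℝ, F)
      (fun q => g.inner (ι q) (b j q • e j (ι q)) (a i q • e i (ι q))) p v =
      g.inner (ι p) (mvfderiv 𝓘(ℝ, F) (a i) p v • e i (ι p)
        + a i p • cov (e i) (ι p) (dι F E ι p v)) (b j p • e j (ι p))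
      + g.inner (ι p) (a i p • e i (ι p)) (mvfderiv 𝓘(ℝ, F) (b j) p v • e j (ι p)
        + b j p • cov (e j) (ι p) (dι F E ι p v)) := by
    intro i j
    have hγ : ContMDiff 𝓘(ℝ, E) 𝓘(ℝ, ℝ) ∞ (fun y => g.inner y (e i y) (e j y)) :=
      IsSmoothAlong.inner (ι := id) (he i) (he j)
    have hcomp : mvfderiv 𝓘(ℝ, F) (fun q => g.inner (ι q) (e i (ι q)) (e j (ι q))) p v =
        g.inner (ι p) (cov (e i) (ι p) (dι F E ι p v)) (e j (ι p))
        + g.inner (ι p) (e i (ι p)) (cov (e j) (ι p) (dι F E ι p v)) := by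
      rw [← hLC.metric (e i) (e j) (ι p) ((he i (ι p)).mdifferentiableAt (by simp))
        ((he j (ι p)).mdifferentiableAt (by simp))]
      exact mvfderiv_comp_apply p ((hγ (ι p)).mdifferentiableAt (by simp))
        ((hι p).mdifferentiableAt (by simp)) v
    have hfun : (fun q => g.inner (ι q) (b j q • e j (ι q)) (a i q • e i (ι q))) =
        (a i * b j) * fun q => g.inner (ι q) (e i (ι q)) (e j (ι q)) := by
      funext q
      simp only [map_smul, smul_apply, smul_eq_mul, Pi.mul_apply]
      rw [g.symm]
      ring
    have da : MDifferentiableAt 𝓘(ℝ, F) 𝓘(ℝ, ℝ) (a i) p := (ha i p).mdifferentiableAt (by simp)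
    have db : MDifferentiableAt 𝓘(ℝ, F) 𝓘(ℝ, ℝ) (b j) p := (hb j p).mdifferentiableAt (by simp)
    have dγ : MDifferentiableAt 𝓘(ℝ, F) 𝓘(ℝ, ℝ)
        (fun q => g.inner (ι q) (e i (ι q)) (e j (ι q))) p :=
      ((hγ.comp hι) p).mdifferentiableAt (by simp)
    rw [hfun, mvfderiv_mul (da.mul db) dγ, mvfderiv_mul da db]
    simp only [add_apply, smul_apply, hcomp, map_add, map_smul, smul_eq_mul, Pi.mul_apply]
    ring
  have h1 : (fun q => g.inner (ι q) (s q) (t q)) =ᶠ[𝓝 p]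
      fun q => g.inner (ι q) (∑ i, a i q • e i (ι q)) (∑ j, b j q • e j (ι q)) := by
    filter_upwards [hsa p rfl, htb p rfl] with q hq hq'
    rw [← hq, ← hq']
  rw [h1.mvfderiv_eq, mvfderiv_inner_along_sum g _ hS hTs, covAlong_eq_sum he ha hι (hsa p rfl),
    covAlong_eq_sum he hb hι (htb p rfl), (hsa p rfl).self_of_nhds, (htb p rfl).self_of_nhds]
  have hbil : ∀ u w : Fin (Module.finrank ℝ E) → TangentSpace 𝓘(ℝ, E) (ι p),
      g.inner (ι p) (∑ i, u i) (∑ j, w j) = ∑ i, ∑ j, g.inner (ι p) (u i) (w j) := by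
    intro u w
    rw [map_sum, Finset.sum_comm]
    refine Finset.sum_congr rfl fun j _ => ?_
    rw [map_sum, sum_apply]
  rw [hbil, hbil, ← Finset.sum_add_distrib]
  refine Finset.sum_congr rfl fun i _ => ?_
  have hflip : (fun q => g.inner (ι q) (a i q • e i (ι q)) (∑ j, b j q • e j (ι q))) =
      fun q => g.inner (ι q) (∑ j, b j q • e j (ι q)) (a i q • e i (ι q)) :=
    funext fun q => g.symm _ _ _
  rw [hflip, mvfderiv_inner_along_sum g _ hT (hS i), ← Finset.sum_add_distrib]
  exact Finset.sum_congr rfl fun j _ => hterm i j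

end Frame

variable [IsManifold 𝓘(ℝ, F) ∞ M]

lemma IsSmoothField.map_dι {X : ∀ p : M, TangentSpace 𝓘(ℝ, F) p} (hX : IsSmoothField X)
    (hι : ContMDiff 𝓘(ℝ, F) 𝓘(ℝ, E) ∞ ι) : IsSmoothAlong F ι (fun q => dι F E ι q (X q)) :=
  (hι.contMDiff_tangentMap (m := ∞) (by simp)).comp hX

/-- Coordinates of a field become derivatives of the chart along it, so the commutator formula
applies to them. -/
lemma coord_eq_mvfderiv {x y : N}
    (hy : y ∈ (trivializationAt E (fun x : N => TangentSpace 𝓘(ℝ, E) x) x).baseSet)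
    (v : TangentSpace 𝓘(ℝ, E) y) :
    coord x y v = mvfderiv 𝓘(ℝ, E) (extChartAt 𝓘(ℝ, E) x) y v := by
  have h := TangentBundle.continuousLinearMapAt_trivializationAt (𝕜 := ℝ) (I := 𝓘(ℝ, E))
    (x₀ := x) (x := y) hy
  have h2 := congrArg (fun L : TangentSpace 𝓘(ℝ, E) y →L[ℝ] E => L v) h
  simp only [Trivialization.continuousLinearMapAt_apply,
    Trivialization.coe_linearMapAt_of_mem _ hy] at h2
  exact h2

variable [FiniteDimensional ℝ E]

lemma IsSmoothAlong.covAlong [T2Space N] (hLC : IsLeviCivita g cov)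
    {X : ∀ p : M, TangentSpace 𝓘(ℝ, F) p}
    (hX : IsSmoothField X) (hs : IsSmoothAlong F ι s) :
    IsSmoothAlong F ι (fun q => covAlong cov ι s q (X q)) := by
  intro p
  have hι := hs.contMDiff
  obtain ⟨e, he, -, hexp⟩ := exists_smooth_frame F M (E := E) (ι p)
  obtain ⟨a, ha, hsa⟩ := hexp ι s hs
  refine contMDiffAt_along_congr (s := fun q => ∑ i, (mvfderiv 𝓘(ℝ, F) (a i) q (X q) • e i (ι q)
      + a i q • cov (e i) (ι q) (dι F E ι q (X q)))) ?_ ?_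
  · refine contMDiffAt_along_sum _ (hι p) fun i _ => contMDiffAt_along_add
      (contMDiffAt_along_smul ((ha i p).mvfderiv_apply (hX p) (by simp)) ((he i).along hι p))
      (contMDiffAt_along_smul (ha i p) ?_)
    have h1 := contMDiffOn_univ.1
      (hLC.smooth.contMDiff.contMDiff (σ := e i) (by simpa using (he i).contMDiffOn))
    exact ContMDiff.clm_bundle_apply (F₁ := E) (F₂ := E) (h1.comp hι) (hX.map_dι hι) p
  · filter_upwards [(hsa p rfl).eventually_nhds] with q hq
    exact covAlong_eq_sum he ha hι hq _

/-- Symmetry of the Christoffel symbols. Both extensions have constant coordinates, so the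
commutator formula applied to the chart gives a zero bracket at x; torsion freeness does the rest.
-/
lemma cov_extend_symm (hLC : IsLeviCivita g cov) {x : N} (v w : TangentSpace 𝓘(ℝ, E) x) :
    cov (FiberBundle.extend E w) x v = cov (FiberBundle.extend E v) x w := by
  have hs : ∀ u : TangentSpace 𝓘(ℝ, E) x, ContMDiffAt 𝓘(ℝ, E) 𝓘(ℝ, E).tangent 2
      (fun y => (⟨y, FiberBundle.extend E u y⟩ : TangentBundle 𝓘(ℝ, E) N)) x :=
    fun u => FiberBundle.contMDiffAt_extend 𝓘(ℝ, E) E u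
  have h1 := cov.torsion_eq_zero_iff.1 hLC.torsion_free
    ((hs v).mdifferentiableAt (by simp)) ((hs w).mdifferentiableAt (by simp))
  rw [FiberBundle.extend_apply_self, FiberBundle.extend_apply_self] at h1
  have hconst : ∀ u : TangentSpace 𝓘(ℝ, E) x,
      (fun y => mvfderiv 𝓘(ℝ, E) (extChartAt 𝓘(ℝ, E) x) y (FiberBundle.extend E u y)) =ᶠ[𝓝 x]
        fun _ => coord x x u := by
    intro u
    filter_upwards [eventually_mem_baseSet_self (E := E) x] with y hy
    rw [← coord_eq_mvfderiv hy, extend_eq hy, coord_uncoord hy]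
  have h2 := mvfderiv_mvfderiv_sub (hs v) (hs w) (contMDiffAt_extChartAt (n := 2) (x := x))
  rw [(hconst v).mvfderiv_eq, (hconst w).mvfderiv_eq, mvfderiv_const, mvfderiv_const,
    ← coord_eq_mvfderiv (FiberBundle.mem_baseSet_trivializationAt' x)] at h2
  rw [← sub_eq_zero, h1, ← uncoord_coord_self x (VectorField.mlieBracket _ _ _ _), ← h2]
  simp

/-- The connection along `ι` is torsion free. -/
lemma covAlong_dι_sub [FiniteDimensional ℝ F] (hLC : IsLeviCivita g cov)
    {X Y : ∀ p : M, TangentSpace 𝓘(ℝ, F) p}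
    (hX : IsSmoothField X) (hY : IsSmoothField Y) (hι : ContMDiff 𝓘(ℝ, F) 𝓘(ℝ, E) ∞ ι) (p : M) :
    Submfd.covAlong cov ι (fun q => dι F E ι q (Y q)) p (X p)
      - Submfd.covAlong cov ι (fun q => dι F E ι q (X q)) p (Y p)
      = dι F E ι p (VectorField.mlieBracket 𝓘(ℝ, F) X Y p) := by
  have hφι : ContMDiffAt 𝓘(ℝ, F) 𝓘(ℝ, E) 2 (fun q => extChartAt 𝓘(ℝ, E) (ι p) (ι q)) p :=
    (contMDiffAt_extChartAt (n := 2)).comp p ((hι p).of_le (by norm_cast))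
  -- The coordinates of dι(Z) are the derivative along Z of the chart composed with ι. The
  -- coordinate parts of the two covariant derivatives thus differ by a commutator, and the
  -- Christoffel parts cancel by `cov_extend_symm`.
  have hcoord : ∀ Z : ∀ p : M, TangentSpace 𝓘(ℝ, F) p,
      (fun q => coord (ι p) (ι q) (dι F E ι q (Z q))) =ᶠ[𝓝 p]
        fun q => mvfderiv 𝓘(ℝ, F) (fun q => extChartAt 𝓘(ℝ, E) (ι p) (ι q)) q (Z q) := by
    intro Z
    filter_upwards [eventually_mem_baseSet (E := E) (hι p).continuousAt] with q hq
    rw [coord_eq_mvfderiv hq]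
    exact (mfderiv_comp_apply q (mdifferentiableAt_extChartAt hq)
      ((hι q).mdifferentiableAt (by simp)) (Z q)).symm
  have hcomm :=
    mvfderiv_mvfderiv_sub ((hX p).of_le (by norm_cast)) ((hY p).of_le (by norm_cast)) hφι
  rw [covAlong_eq, covAlong_eq, (hcoord X).mvfderiv_eq, (hcoord Y).mvfderiv_eq]
  have hbr : uncoord (ι p) (ι p) (mvfderiv 𝓘(ℝ, F) (fun q => extChartAt 𝓘(ℝ, E) (ι p) (ι q)) p
      (VectorField.mlieBracket 𝓘(ℝ, F) X Y p)) =
      dι F E ι p (VectorField.mlieBracket 𝓘(ℝ, F) X Y p) := by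
    have h := (hcoord (VectorField.mlieBracket 𝓘(ℝ, F) X Y)).self_of_nhds
    beta_reduce at h
    rw [← h, uncoord_coord_self]
  rw [← hbr, ← hcomm, map_sub]
  have hext := cov_extend_symm hLC (dι F E ι p (X p)) (dι F E ι p (Y p))
  rw [hext]
  abel

end LeviCivita

end Submfd


/-! ### Smooth dependence of determinants and inverse matrices. -/

section MatrixSmooth

variable {F : Type*} [NormedAddCommGroup F] [NormedSpace ℝ F]
  {M : Type*} [TopologicalSpace M] [ChartedSpace F M] {n : ℕ∞ω} {p : M}
  {κ : Type*} [Fintype κ] [DecidableEq κ] {A : M → Matrix κ κ ℝ}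

lemma contMDiffAt_matrix_det
    (hA : ∀ i j, ContMDiffAt 𝓘(ℝ, F) 𝓘(ℝ, ℝ) n (fun q => A q i j) p) :
    ContMDiffAt 𝓘(ℝ, F) 𝓘(ℝ, ℝ) n (fun q => (A q).det) p := by
  simp only [Matrix.det_apply']
  exact ContMDiffAt.sum fun σ _ =>
    contMDiffAt_const.mul (ContMDiffAt.prod fun i _ => hA _ _)

lemma contMDiffAt_matrix_inv
    (hA : ∀ i j, ContMDiffAt 𝓘(ℝ, F) 𝓘(ℝ, ℝ) n (fun q => A q i j) p) (hdet : (A p).det ≠ 0)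
    (i j : κ) : ContMDiffAt 𝓘(ℝ, F) 𝓘(ℝ, ℝ) n (fun q => (A q)⁻¹ i j) p := by
  simp only [Matrix.inv_def, Ring.inverse_eq_inv', Matrix.smul_apply]
  refine ((contMDiffAt_matrix_det hA).inv₀ hdet).smul ?_
  simp only [Matrix.adjugate_apply]
  refine contMDiffAt_matrix_det fun k l => ?_
  by_cases hk : k = j
  · subst hk
    simpa using contMDiffAt_const
  · simpa [Matrix.updateRow_ne hk] using hA k l

end MatrixSmooth

namespace Submfd

open Filter
open scoped Topology

/-! ### Tangential and normal parts: uniqueness, linearity and smoothness. -/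

section Parts

variable {F : Type*} [NormedAddCommGroup F] [NormedSpace ℝ F]
  {M : Type*} [TopologicalSpace M] [ChartedSpace F M]
  {E : Type*} [NormedAddCommGroup E] [NormedSpace ℝ E]
  {N : Type*} [TopologicalSpace N] [ChartedSpace E N] [IsManifold 𝓘(ℝ, E) ∞ N]
  {g : ContMDiffRiemannianMetric 𝓘(ℝ, E) ∞ E (fun x : N => TangentSpace 𝓘(ℝ, E) x)}
  {ι : M → N} {p : M}

lemma eq_zero_of_inner_self {x : N} {v : TangentSpace 𝓘(ℝ, E) x} (h : g.inner x v v = 0) :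
    v = 0 := by
  by_contra hv
  exact (g.pos x v hv).ne' h

variable [FiniteDimensional ℝ E]

variable (g ι) in
lemma inner_normalPart_dι (p : M) (w : TangentSpace 𝓘(ℝ, E) (ι p)) (u : TangentSpace 𝓘(ℝ, F) p) :
    g.inner (ι p) (normalPart F g ι p w) (dι F E ι p u) = 0 :=
  (exists_tangentPart g ι p w).choose_spec u

variable (g ι) in
lemma dι_tangentPart_add_normalPart (p : M) (w : TangentSpace 𝓘(ℝ, E) (ι p)) :
    dι F E ι p (tangentPart g ι p w) + normalPart F g ι p w = w :=
  add_sub_cancel _ _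

/-- `tangentPart` is a choice from an existence statement. Two candidates differ by a vector whose
image under dι is both tangential and normal, hence zero by positivity of g; injectivity of dι then
identifies them. -/
lemma tangentPart_unique (hι : IsImmersed F E ι) {v : TangentSpace 𝓘(ℝ, F) p}
    {ν : TangentSpace 𝓘(ℝ, E) (ι p)} (hν : ∀ u, g.inner (ι p) ν (dι F E ι p u) = 0) :
    tangentPart g ι p (dι F E ι p v + ν) = v := by
  set w := dι F E ι p v + ν with hw
  have h1 : dι F E ι p (tangentPart g ι p w - v) = ν - normalPart F g ι p w := by
    rw [map_sub, sub_eq_sub_iff_add_eq_add, dι_tangentPart_add_normalPart, hw, add_comm]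
  have h2 : dι F E ι p (tangentPart g ι p w - v) = 0 := by
    refine eq_zero_of_inner_self (g := g) ?_
    nth_rewrite 1 [h1]
    rw [map_sub, sub_apply, hν, inner_normalPart_dι, sub_zero]
  rw [← map_zero (dι F E ι p)] at h2
  exact sub_eq_zero.1 (hι.injective p h2)

lemma normalPart_unique (hι : IsImmersed F E ι) {v : TangentSpace 𝓘(ℝ, F) p}
    {ν : TangentSpace 𝓘(ℝ, E) (ι p)} (hν : ∀ u, g.inner (ι p) ν (dι F E ι p u) = 0) :
    normalPart F g ι p (dι F E ι p v + ν) = ν := by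
  rw [normalPart, tangentPart_unique hι hν, add_sub_cancel_left]

lemma tangentPart_dι (hι : IsImmersed F E ι) (v : TangentSpace 𝓘(ℝ, F) p) :
    tangentPart g ι p (dι F E ι p v) = v := by
  simpa using tangentPart_unique (g := g) hι (v := v) (ν := 0) (by simp)

lemma normalPart_dι (hι : IsImmersed F E ι) (v : TangentSpace 𝓘(ℝ, F) p) :
    normalPart F g ι p (dι F E ι p v) = 0 := by
  simpa using normalPart_unique (g := g) hι (v := v) (ν := 0) (by simp)

lemma normalPart_of_normal (hι : IsImmersed F E ι) {ν : TangentSpace 𝓘(ℝ, E) (ι p)}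
    (hν : ∀ u, g.inner (ι p) ν (dι F E ι p u) = 0) : normalPart F g ι p ν = ν := by
  simpa using normalPart_unique hι (v := 0) hν

lemma tangentPart_add (hι : IsImmersed F E ι) (w w' : TangentSpace 𝓘(ℝ, E) (ι p)) :
    (tangentPart g ι p (w + w') : TangentSpace 𝓘(ℝ, F) p) =
      tangentPart g ι p w + tangentPart g ι p w' := by
  have h : w + w' = dι F E ι p (tangentPart g ι p w + tangentPart g ι p w')
      + (normalPart F g ι p w + normalPart F g ι p w') := by
    nth_rewrite 1 [← dι_tangentPart_add_normalPart (F := F) g ι p w,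
      ← dι_tangentPart_add_normalPart (F := F) g ι p w']
    rw [map_add]
    abel
  rw [h]
  refine tangentPart_unique hι fun u => ?_
  rw [map_add, add_apply, inner_normalPart_dι, inner_normalPart_dι, add_zero]

lemma tangentPart_smul (hι : IsImmersed F E ι) (a : ℝ) (w : TangentSpace 𝓘(ℝ, E) (ι p)) :
    (tangentPart g ι p (a • w) : TangentSpace 𝓘(ℝ, F) p) = a • tangentPart g ι p w := by
  have h : a • w = dι F E ι p (a • tangentPart g ι p w) + a • normalPart F g ι p w := by
    nth_rewrite 1 [← dι_tangentPart_add_normalPart (F := F) g ι p w]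
    rw [map_smul, smul_add]
  rw [h]
  refine tangentPart_unique hι fun u => ?_
  rw [map_smul, smul_apply, inner_normalPart_dι, smul_zero]

lemma tangentPart_sub (hι : IsImmersed F E ι) (w w' : TangentSpace 𝓘(ℝ, E) (ι p)) :
    (tangentPart g ι p (w - w') : TangentSpace 𝓘(ℝ, F) p) =
      tangentPart g ι p w - tangentPart g ι p w' := by
  have h := tangentPart_add (g := g) hι w ((-1 : ℝ) • w')
  rw [tangentPart_smul hι] at h
  simpa [sub_eq_add_neg] using h

lemma normalPart_add (hι : IsImmersed F E ι) (w w' : TangentSpace 𝓘(ℝ, E) (ι p)) :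
    normalPart F g ι p (w + w') = normalPart F g ι p w + normalPart F g ι p w' := by
  simp only [normalPart, tangentPart_add hι, map_add]
  abel

lemma normalPart_sub (hι : IsImmersed F E ι) (w w' : TangentSpace 𝓘(ℝ, E) (ι p)) :
    normalPart F g ι p (w - w') = normalPart F g ι p w - normalPart F g ι p w' := by
  simp only [normalPart, tangentPart_sub hι, map_sub]
  abel

variable [FiniteDimensional ℝ F] [T2Space M] [IsManifold 𝓘(ℝ, F) ∞ M]

/-- In a local frame u the coefficients of the tangential part solve a linear system with the Gram
matrix of dι(u) as its matrix, and the inverse of that matrix is smooth. -/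
lemma IsSmoothAlong.tangentPart (hι : IsImmersed F E ι) {s : ∀ p : M, TangentSpace 𝓘(ℝ, E) (ι p)}
    (hs : IsSmoothAlong F ι s) :
    IsSmoothField (fun q => (tangentPart g ι q (s q) : TangentSpace 𝓘(ℝ, F) q)) := by
  intro p
  obtain ⟨u, hu, hub, -⟩ := exists_smooth_frame F M (E := F) p
  let A : M → Matrix (Fin (Module.finrank ℝ F)) (Fin (Module.finrank ℝ F)) ℝ := fun q i j =>
    g.inner (ι q) (dι F E ι q (u i q)) (dι F E ι q (u j q))
  let β : M → Fin (Module.finrank ℝ F) → ℝ := fun q i =>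
    g.inner (ι q) (s q) (dι F E ι q (u i q))
  have hA : ∀ i j, ContMDiff 𝓘(ℝ, F) 𝓘(ℝ, ℝ) ∞ (fun q => A q i j) := fun i j =>
    ((hu i).map_dι hι.smooth).inner ((hu j).map_dι hι.smooth)
  have hβ : ∀ i, ContMDiff 𝓘(ℝ, F) 𝓘(ℝ, ℝ) ∞ (fun q => β q i) := fun i =>
    hs.inner ((hu i).map_dι hι.smooth)
  have hdet : ∀ q, (∃ b : Module.Basis (Fin (Module.finrank ℝ F)) ℝ
        (TangentSpace 𝓘(ℝ, F) q), ∀ i, b i = u i q) → (A q).det ≠ 0 := by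
    -- A kernel vector of the Gram matrix gives a combination of the frame whose image has length
    -- zero.
    rintro q ⟨b, hb⟩ h0
    obtain ⟨x, hx, hAx⟩ := Matrix.exists_mulVec_eq_zero_iff.2 h0
    have h1 : dι F E ι q (∑ j, x j • u j q) = 0 := by
      refine eq_zero_of_inner_self (g := g) ?_
      nth_rewrite 1 [map_sum]
      rw [map_sum, sum_apply]
      refine Finset.sum_eq_zero fun i _ => ?_
      have h2 := congrFun hAx i
      simp only [Matrix.mulVec, dotProduct, Pi.zero_apply] at h2
      simp only [map_smul, smul_apply, map_sum, smul_eq_mul]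
      calc _ = x i * ∑ j, A q i j * x j := by
            rw [Finset.mul_sum]
            exact Finset.sum_congr rfl fun j _ => by simp only [A]; ring
        _ = 0 := by rw [h2, mul_zero]
    rw [← map_zero (dι F E ι q)] at h1
    have h3 := hι.injective q h1
    apply hx
    funext i
    simp only [← hb] at h3
    have := congrArg (fun v => b.repr v i) h3
    simpa [map_sum, Finsupp.single_apply] using this
  refine contMDiffAt_along_congr (ι := (id : M → M))
    (s := fun q => ∑ j, ((A q)⁻¹.mulVec (β q)) j • u j q) ?_ ?_
  · refine contMDiffAt_along_sum (ι := (id : M → M)) _ contMDiffAt_id fun j _ =>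
      contMDiffAt_along_smul (ι := (id : M → M)) ?_ (hu j p)
    simp only [Matrix.mulVec, dotProduct]
    exact ContMDiffAt.sum fun k _ =>
      (contMDiffAt_matrix_inv (fun i j => hA i j p) (hdet p hub.self_of_nhds) j k).mul (hβ k p)
  · filter_upwards [hub] with q hq
    have hq' := hdet q hq
    obtain ⟨b, hb⟩ := hq
    set v : TangentSpace 𝓘(ℝ, F) q := ∑ j, ((A q)⁻¹.mulVec (β q)) j • u j q with hv
    have key : ∀ i, g.inner (ι q) (s q - dι F E ι q v) (dι F E ι q (u i q)) = 0 := by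
      intro i
      have h1 : (A q).mulVec ((A q)⁻¹.mulVec (β q)) i = β q i := by
        rw [Matrix.mulVec_mulVec, Matrix.mul_nonsing_inv _ (isUnit_iff_ne_zero.2 hq'),
          Matrix.one_mulVec]
      rw [map_sub, sub_apply, sub_eq_zero]
      change β q i = _
      rw [← h1, g.symm, hv]
      simp only [map_sum, map_smul, Matrix.mulVec, dotProduct, smul_eq_mul]
      exact Finset.sum_congr rfl fun j _ => mul_comm _ _
    have key' : ∀ w, g.inner (ι q) (s q - dι F E ι q v) (dι F E ι q w) = 0 := by
      intro w
      rw [← b.sum_repr w]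
      simp only [map_sum, map_smul, hb, key, smul_zero, Finset.sum_const_zero]
    have h2 := tangentPart_unique hι (v := v) key'
    rw [add_sub_cancel] at h2
    exact h2

lemma IsSmoothAlong.normalPart (hι : IsImmersed F E ι) {s : ∀ p : M, TangentSpace 𝓘(ℝ, E) (ι p)}
    (hs : IsSmoothAlong F ι s) : IsSmoothAlong F ι (fun q => normalPart F g ι q (s q)) :=
  hs.sub ((hs.tangentPart hι).map_dι hι.smooth)

end Parts

end Submfd


namespace Submfd

/-! ### The induced connection and the symmetries of its curvature. -/

section Geometry

variable {F : Type*} [NormedAddCommGroup F] [NormedSpace ℝ F]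
  {M : Type*} [TopologicalSpace M] [ChartedSpace F M]
  {E : Type*} [NormedAddCommGroup E] [NormedSpace ℝ E]
  {N : Type*} [TopologicalSpace N] [ChartedSpace E N] [IsManifold 𝓘(ℝ, E) ∞ N]
  {g : ContMDiffRiemannianMetric 𝓘(ℝ, E) ∞ E (fun x : N => TangentSpace 𝓘(ℝ, E) x)}
  {cov : CovariantDerivative 𝓘(ℝ, E) E (fun x : N => TangentSpace 𝓘(ℝ, E) x)}
  {ι : M → N} {X Y Z W : ∀ p : M, TangentSpace 𝓘(ℝ, F) p}

lemma covAlong_neg_right (p : M) (s : ∀ p : M, TangentSpace 𝓘(ℝ, E) (ι p))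
    (v : TangentSpace 𝓘(ℝ, F) p) : covAlong cov ι s p (-v) = -covAlong cov ι s p v := by
  simp only [covAlong_eq, map_neg, neg_add]

variable [FiniteDimensional ℝ E]

lemma dι_nabla_add_sff (p : M) :
    dι F E ι p (nabla g cov ι X Y p) + sff g cov ι X Y p =
      covAlong cov ι (fun q => dι F E ι q (Y q)) p (X p) :=
  dι_tangentPart_add_normalPart g ι p _

lemma nabla_mlieBracket_swap (hι : IsImmersed F E ι) (p : M) :
    Submfd.nabla g cov ι (VectorField.mlieBracket 𝓘(ℝ, F) X Y) Z p =
      -Submfd.nabla g cov ι (VectorField.mlieBracket 𝓘(ℝ, F) Y X) Z p := by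
  rw [Submfd.nabla, VectorField.mlieBracket_swap_apply, covAlong_neg_right, ← neg_one_smul ℝ,
    tangentPart_smul hι, neg_one_smul]
  rfl

lemma curv_swap (hι : IsImmersed F E ι) (p : M) :
    Submfd.curv g cov ι X Y Z p = -Submfd.curv g cov ι Y X Z p := by
  rw [Submfd.curv, Submfd.curv, nabla_mlieBracket_swap hι]
  abel

variable [IsManifold 𝓘(ℝ, F) ∞ M]

lemma IsSmoothField.sub (hX : IsSmoothField X) (hY : IsSmoothField Y) :
    IsSmoothField (fun q => X q - Y q) :=
  IsSmoothAlong.sub (ι := (id : M → M)) hX hY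

lemma nabla_sub_right (hι : IsImmersed F E ι) (hY : IsSmoothField Y)
    (hZ : IsSmoothField Z) (p : M) :
    Submfd.nabla g cov ι X (fun q => Y q - Z q) p =
      Submfd.nabla g cov ι X Y p - Submfd.nabla g cov ι X Z p := by
  simp only [Submfd.nabla, ← tangentPart_sub hι]
  congr 1
  rw [eq_sub_iff_add_eq, ← covAlong_add ((hY.sub hZ).map_dι hι.smooth) (hZ.map_dι hι.smooth)]
  congr 1
  funext q
  simp

lemma mvfderiv_metric [T2Space N] (hLC : IsLeviCivita g cov) (hι : IsImmersed F E ι)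
    (hY : IsSmoothField Y) (hZ : IsSmoothField Z) (p : M) :
    mvfderiv 𝓘(ℝ, F) (fun q => metric g ι q (Y q) (Z q)) p (X p) =
      metric g ι p (nabla g cov ι X Y p) (Z p) + metric g ι p (Y p) (nabla g cov ι X Z p) := by
  have h := mvfderiv_inner_along hLC (hY.map_dι hι.smooth) (hZ.map_dι hι.smooth) (X p)
  rw [← dι_nabla_add_sff (g := g), ← dι_nabla_add_sff (g := g), map_add, map_add, add_apply] at h
  rw [show g.inner (ι p) (sff g cov ι X Y p) (dι F E ι p (Z p)) = 0 from
    inner_normalPart_dι .., g.symm _ _ (sff g cov ι X Z p),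
    show g.inner (ι p) (sff g cov ι X Z p) (dι F E ι p (Y p)) = 0 from
    inner_normalPart_dι .., add_zero, add_zero] at h
  exact h

variable [FiniteDimensional ℝ F]

lemma nabla_sub_nabla (hLC : IsLeviCivita g cov) (hι : IsImmersed F E ι)
    (hX : IsSmoothField X) (hY : IsSmoothField Y) (p : M) :
    nabla g cov ι X Y p - nabla g cov ι Y X p = VectorField.mlieBracket 𝓘(ℝ, F) X Y p := by
  rw [nabla, nabla, ← tangentPart_sub hι, covAlong_dι_sub hLC hX hY hι.smooth, tangentPart_dι hι]

lemma sff_comm (hLC : IsLeviCivita g cov) (hι : IsImmersed F E ι)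
    (hX : IsSmoothField X) (hY : IsSmoothField Y) (p : M) :
    sff g cov ι X Y p = sff g cov ι Y X p := by
  rw [← sub_eq_zero, sff, sff, ← normalPart_sub hι, covAlong_dι_sub hLC hX hY hι.smooth,
    normalPart_dι hι]

lemma IsSmoothField.mlieBracket (hX : IsSmoothField X) (hY : IsSmoothField Y) :
    IsSmoothField (VectorField.mlieBracket 𝓘(ℝ, F) X Y) := by
  have : CompleteSpace F := FiniteDimensional.complete ℝ F
  have : IsManifold 𝓘(ℝ, F) (minSmoothness ℝ 2) M := by
    rw [minSmoothness_of_isRCLikeNormedField]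
    infer_instance
  have : IsManifold 𝓘(ℝ, F) (((⊤ : ℕ∞) : ℕ∞ω) + 1) M := by simpa
  exact ContDiff.mlieBracket_vectorField (m := ⊤) (n := ⊤) hX hY
    (by simp [minSmoothness_of_isRCLikeNormedField])

variable [T2Space M] [T2Space N]

lemma IsSmoothField.nabla (hLC : IsLeviCivita g cov) (hι : IsImmersed F E ι)
    (hX : IsSmoothField X) (hY : IsSmoothField Y) : IsSmoothField (nabla g cov ι X Y) :=
  ((hY.map_dι hι.smooth).covAlong hLC hX).tangentPart hι

lemma IsSmoothField.sff (hLC : IsLeviCivita g cov) (hι : IsImmersed F E ι)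
    (hX : IsSmoothField X) (hY : IsSmoothField Y) : IsSmoothAlong F ι (sff g cov ι X Y) :=
  ((hY.map_dι hι.smooth).covAlong hLC hX).normalPart hι

lemma IsSmoothField.curv (hLC : IsLeviCivita g cov) (hι : IsImmersed F E ι)
    (hX : IsSmoothField X) (hY : IsSmoothField Y) (hZ : IsSmoothField Z) :
    IsSmoothField (curv g cov ι X Y Z) :=
  ((hX.nabla hLC hι (hY.nabla hLC hι hZ)).sub (hY.nabla hLC hι (hX.nabla hLC hι hZ))).sub
    ((hX.mlieBracket hY).nabla hLC hι hZ)

/-- Torsion freeness, applied twice, turns each nested bracket into covariant derivatives (`key`);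
the Jacobi identity for brackets then becomes the cyclic sum. -/
lemma curv_bianchi (hLC : IsLeviCivita g cov) (hι : IsImmersed F E ι)
    (hX : IsSmoothField X) (hY : IsSmoothField Y) (hZ : IsSmoothField Z) (p : M) :
    Submfd.curv g cov ι X Y Z p + Submfd.curv g cov ι Y Z X p
      + Submfd.curv g cov ι Z X Y p = 0 := by
  have : CompleteSpace F := FiniteDimensional.complete ℝ F
  have : IsManifold 𝓘(ℝ, F) (minSmoothness ℝ 3) M := by
    rw [minSmoothness_of_isRCLikeNormedField]
    infer_instance
  have key : ∀ {A B C : ∀ p : M, TangentSpace 𝓘(ℝ, F) p}, IsSmoothField A → IsSmoothField B →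
      IsSmoothField C →
      Submfd.nabla g cov ι A (Submfd.nabla g cov ι B C) p
        - Submfd.nabla g cov ι A (Submfd.nabla g cov ι C B) p
        - Submfd.nabla g cov ι (VectorField.mlieBracket 𝓘(ℝ, F) B C) A p
        = VectorField.mlieBracket 𝓘(ℝ, F) A (VectorField.mlieBracket 𝓘(ℝ, F) B C) p := by
    intro A B C hA hB hC
    rw [← nabla_sub_nabla hLC hι hA (hB.mlieBracket hC),
      ← nabla_sub_right hι (hB.nabla hLC hι hC) (hC.nabla hLC hι hB)]
    congr 3
    funext q
    exact nabla_sub_nabla hLC hι hB hC q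
  have hle : minSmoothness ℝ 2 ≤ ∞ := by
    rw [minSmoothness_of_isRCLikeNormedField]
    exact ENat.LEInfty.out
  have hJ := VectorField.leibniz_identity_mlieBracket_apply (I := 𝓘(ℝ, F))
    ((hX p).of_le hle) ((hY p).of_le hle) ((hZ p).of_le hle)
  rw [VectorField.mlieBracket_swap_apply (V := VectorField.mlieBracket 𝓘(ℝ, F) X Y),
    ← key hX hY hZ, ← key hZ hX hY, ← key hY hX hZ,
    nabla_mlieBracket_swap hι (X := X) (Y := Z)] at hJ
  rw [← sub_eq_zero] at hJ
  rw [← hJ]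
  simp only [Submfd.curv]
  abel

/-- Apply the commutator formula to the function g(Z,W). The mixed terms g(∇Z,∇W) are symmetric in X
and Y and drop out. -/
lemma metric_curv_antisymm (hLC : IsLeviCivita g cov) (hι : IsImmersed F E ι)
    (hX : IsSmoothField X) (hY : IsSmoothField Y) (hZ : IsSmoothField Z) (hW : IsSmoothField W)
    (p : M) :
    metric g ι p (Submfd.curv g cov ι X Y Z p) (W p)
      + metric g ι p (Z p) (Submfd.curv g cov ι X Y W p) = 0 := by
  have hsm : ∀ {A B : ∀ p : M, TangentSpace 𝓘(ℝ, F) p}, IsSmoothField A → IsSmoothField B →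
      ContMDiff 𝓘(ℝ, F) 𝓘(ℝ, ℝ) ∞ (fun q => metric g ι q (A q) (B q)) := fun hA hB =>
    (hA.map_dι hι.smooth).inner (hB.map_dι hι.smooth)
  have hle : (2 : ℕ∞ω) ≤ ∞ := ENat.LEInfty.out
  have h := mvfderiv_mvfderiv_sub ((hX p).of_le hle) ((hY p).of_le hle) ((hsm hZ hW p).of_le hle)
  have second : ∀ {A B : ∀ p : M, TangentSpace 𝓘(ℝ, F) p}, IsSmoothField A → IsSmoothField B →
      mvfderiv 𝓘(ℝ, F) (fun q => mvfderiv 𝓘(ℝ, F) (fun q => metric g ι q (Z q) (W q)) q (B q))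
        p (A p) =
      metric g ι p (Submfd.nabla g cov ι A (Submfd.nabla g cov ι B Z) p) (W p)
        + metric g ι p (Submfd.nabla g cov ι B Z p) (Submfd.nabla g cov ι A W p)
        + (metric g ι p (Submfd.nabla g cov ι A Z p) (Submfd.nabla g cov ι B W p)
        + metric g ι p (Z p) (Submfd.nabla g cov ι A (Submfd.nabla g cov ι B W) p)) := by
    intro A B hA hB
    simp only [mvfderiv_metric hLC hι hZ hW]
    rw [← mvfderiv_metric hLC hι (hB.nabla hLC hι hZ) hW,
      ← mvfderiv_metric hLC hι hZ (hB.nabla hLC hι hW)]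
    have h1 := ((hsm (hB.nabla hLC hι hZ) hW) p).mdifferentiableAt (by simp)
    have h2 := ((hsm hZ (hB.nabla hLC hι hW)) p).mdifferentiableAt (by simp)
    exact congrArg (fun L : F →L[ℝ] ℝ => L (A p)) (mfderiv_add h1 h2)
  rw [second hX hY, second hY hX, mvfderiv_metric hLC hι hZ hW] at h
  simp only [metric, Submfd.curv, map_sub, sub_apply] at h ⊢
  linarith

end Geometry

end Submfd


/-! ### Algebraic curvature tensors. -/

section CurvatureLike

variable {V : Type*} {K : V → V → V → V → ℝ}

/-- The pair symmetry of a map with the other algebraic symmetries of a curvature tensor. -/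
lemma curvatureLike_pair_symm (h₁₂ : ∀ x y z w, K x y z w = -K y x z w)
    (h₃₄ : ∀ x y z w, K x y z w = -K x y w z)
    (hb : ∀ x y z w, K x y z w + K y z x w + K z x y w = 0) (x y z w : V) :
    K x y z w = K z w x y := by
  -- The Bianchi identity is used at the four cyclic shifts of (x, y, z, w).
  linarith [hb x y z w, hb y z w x, hb z w x y, hb w x y z, h₃₄ y z x w, h₁₂ z x y w,
    h₃₄ x z y w, h₁₂ w y z x, h₃₄ y w z x, h₃₄ w x z y, h₃₄ x y z w, h₃₄ z w x y]

/-- A curvature-like map is determined by its sectional curvatures. -/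
lemma curvatureLike_eq_zero [AddCommGroup V] (h₁₂ : ∀ x y z w, K x y z w = -K y x z w)
    (h₃₄ : ∀ x y z w, K x y z w = -K x y w z)
    (hb : ∀ x y z w, K x y z w + K y z x w + K z x y w = 0)
    (hadd : ∀ x y z w w', K x y z (w + w') = K x y z w + K x y z w')
    (hsec : ∀ x y, K x y y x = 0) (x y z w : V) : K x y z w = 0 := by
  have hp := curvatureLike_pair_symm h₁₂ h₃₄ hb
  have hadd₃ : ∀ x y z z' w, K x y (z + z') w = K x y z w + K x y z' w := fun x y z z' w => by
    rw [h₃₄, hadd, h₃₄ x y z, h₃₄ x y z']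
    ring
  have hadd₂ : ∀ x y y' z w, K x (y + y') z w = K x y z w + K x y' z w := fun x y y' z w => by
    rw [hp, hadd, hp z w x y, hp z w x y']
  have hadd₁ : ∀ x x' y z w, K (x + x') y z w = K x y z w + K x' y z w := fun x x' y z w => by
    rw [hp, hadd₃, hp z w x y, hp z w x' y]
  -- Polarization of `hsec` in the outer variable; `h2` then polarizes in the middle one.
  have h1 : ∀ x y z, K x y y z = 0 := by
    intro x y z
    have h := hsec (x + z) y
    rw [hadd₁, hadd, hadd, hsec, hsec] at h
    linarith [hp z y y x, h₁₂ y x z y, h₃₄ x y z y]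
  have h2 : ∀ x y z w, K x y z w = -K x z y w := by
    intro x y z w
    have h := h1 x (y + z) w
    rw [hadd₂, hadd₃, hadd₃, h1, h1] at h
    linarith
  -- Skewness in the middle pair makes the three Bianchi terms equal, so 3K = 0.
  linarith [hb x y z w, h2 x y z w, h₁₂ x z y w, h2 y z x w, h₁₂ y x z w]

end CurvatureLike

namespace Submfd

/-! ### The pointwise metric and the curvature tensor of a space of constant curvature. -/

section ConstantCurvature

variable {F : Type*} [NormedAddCommGroup F] [NormedSpace ℝ F]
  {M : Type*} [TopologicalSpace M] [ChartedSpace F M]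
  {E : Type*} [NormedAddCommGroup E] [NormedSpace ℝ E]
  {N : Type*} [TopologicalSpace N] [ChartedSpace E N] [IsManifold 𝓘(ℝ, E) ∞ N]
  {g : ContMDiffRiemannianMetric 𝓘(ℝ, E) ∞ E (fun x : N => TangentSpace 𝓘(ℝ, E) x)}
  {cov : CovariantDerivative 𝓘(ℝ, E) E (fun x : N => TangentSpace 𝓘(ℝ, E) x)}
  {ι : M → N} {p : M}

lemma metric_comm (v w : TangentSpace 𝓘(ℝ, F) p) : metric g ι p v w = metric g ι p w v :=
  g.symm _ _ _

lemma metric_add_left (v v' w : TangentSpace 𝓘(ℝ, F) p) :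
    metric g ι p (v + v') w = metric g ι p v w + metric g ι p v' w := by
  simp only [metric, map_add, add_apply]

lemma metric_smul_left (a : ℝ) (v w : TangentSpace 𝓘(ℝ, F) p) :
    metric g ι p (a • v) w = a * metric g ι p v w := by
  simp only [metric, map_smul, smul_apply, smul_eq_mul]

lemma metric_add_right (v w w' : TangentSpace 𝓘(ℝ, F) p) :
    metric g ι p v (w + w') = metric g ι p v w + metric g ι p v w' := by
  simp only [metric, map_add]

lemma metric_neg_left (v w : TangentSpace 𝓘(ℝ, F) p) :
    metric g ι p (-v) w = -metric g ι p v w := by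
  simp only [metric, map_neg, neg_apply]

lemma metric_sub_left (v v' w : TangentSpace 𝓘(ℝ, F) p) :
    metric g ι p (v - v') w = metric g ι p v w - metric g ι p v' w := by
  simp only [metric, map_sub, sub_apply]

lemma eq_zero_of_metric_self (hι : IsImmersed F E ι) {v : TangentSpace 𝓘(ℝ, F) p}
    (h : metric g ι p v v = 0) : v = 0 := by
  have h1 : dι F E ι p v = 0 := eq_zero_of_inner_self (g := g) h
  rw [← map_zero (dι F E ι p)] at h1
  exact hι.injective p h1

/-- A vector in a space of dimension at least two has a nonzero orthogonal vector. -/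
lemma exists_ne_zero_metric_eq_zero [FiniteDimensional ℝ F] (hF : 1 < Module.finrank ℝ F) (p : M)
    (v : TangentSpace 𝓘(ℝ, F) p) :
    ∃ w : TangentSpace 𝓘(ℝ, F) p, w ≠ 0 ∧ metric g ι p v w = 0 := by
  let L : TangentSpace 𝓘(ℝ, F) p →ₗ[ℝ] ℝ :=
    ((g.inner (ι p) (dι F E ι p v)).comp (dι F E ι p)).toLinearMap
  have : FiniteDimensional ℝ (TangentSpace 𝓘(ℝ, F) p) := inferInstanceAs (FiniteDimensional ℝ F)
  have hL : LinearMap.ker L ≠ ⊥ :=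
    LinearMap.ker_ne_bot_of_finrank_lt (by
      rw [Module.finrank_self]
      exact hF)
  obtain ⟨w, hw, hw0⟩ := Submodule.exists_mem_ne_zero_of_ne_bot hL
  exact ⟨w, hw0, hw⟩

variable [IsManifold 𝓘(ℝ, F) ∞ M]

variable (F M) in
/-- The additive group of smooth vector fields. -/
def smoothFields : AddSubgroup (∀ p : M, TangentSpace 𝓘(ℝ, F) p) where
  carrier := {X | IsSmoothField X}
  add_mem' hX hY := IsSmoothAlong.add (ι := (id : M → M)) hX hY
  zero_mem' _ := contMDiffAt_along_zero (ι := (id : M → M)) contMDiffAt_id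
  neg_mem' hX := IsSmoothAlong.neg (ι := (id : M → M)) hX

variable [FiniteDimensional ℝ F] [T2Space M] [FiniteDimensional ℝ E] [T2Space N]
  {c : ℝ} {X Y Z : ∀ p : M, TangentSpace 𝓘(ℝ, F) p}

/-- The curvature tensor of a submanifold of constant sectional curvature. -/
lemma HasConstantCurvature.curv_eq (hc : HasConstantCurvature F g cov ι c)
    (hLC : IsLeviCivita g cov) (hι : IsImmersed F E ι) (hX : IsSmoothField X)
    (hY : IsSmoothField Y) (hZ : IsSmoothField Z) (p : M) :
    curv g cov ι X Y Z p =
      c • (metric g ι p (Y p) (Z p) • X p - metric g ι p (X p) (Z p) • Y p) := by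
  -- K is the curvature minus its constant-curvature model. Its arguments are fields because `curv`
  -- is defined on fields; additivity is checked directly only in the last slot, where K depends on
  -- w(p) alone.
  let K : smoothFields F M → smoothFields F M → smoothFields F M → smoothFields F M → ℝ :=
    fun x y z w => metric g ι p (curv g cov ι x.1 y.1 z.1 p) (w.1 p)
      - c * (metric g ι p (y.1 p) (z.1 p) * metric g ι p (x.1 p) (w.1 p)
        - metric g ι p (x.1 p) (z.1 p) * metric g ι p (y.1 p) (w.1 p))
  have hK : ∀ x y z w, K x y z w = 0 := by
    refine curvatureLike_eq_zero ?_ ?_ ?_ ?_ ?_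
    · intro x y z w
      simp only [K]
      rw [curv_swap hι, metric_neg_left]
      ring
    · intro x y z w
      have h := metric_curv_antisymm hLC hι x.2 y.2 z.2 w.2 p
      rw [metric_comm (z.1 p)] at h
      simp only [K]
      linarith
    · intro x y z w
      have h := congrArg (fun v => metric g ι p v (w.1 p)) (curv_bianchi hLC hι x.2 y.2 z.2 p)
      simp only [metric_add_left] at h
      rw [show metric g ι p 0 (w.1 p) = 0 by simp [metric]] at h
      simp only [K, metric_comm (z.1 p) (x.1 p), metric_comm (z.1 p) (y.1 p),
        metric_comm (y.1 p) (x.1 p)]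
      linarith
    · intro x y z w w'
      simp only [K, AddSubgroup.coe_add, Pi.add_apply, metric_add_right]
      ring
    · intro x y
      simp only [K, hc _ _ x.2 y.2 p, metric_comm (y.1 p) (x.1 p)]
      ring
  rw [← sub_eq_zero]
  set v := curv g cov ι X Y Z p
    - c • (metric g ι p (Y p) (Z p) • X p - metric g ι p (X p) (Z p) • Y p) with hv
  obtain ⟨W, hW, hWp⟩ := exists_isSmoothField_eq p v
  refine eq_zero_of_metric_self (g := g) hι ?_
  rw [← hK ⟨X, hX⟩ ⟨Y, hY⟩ ⟨Z, hZ⟩ ⟨W, hW⟩]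
  simp only [K, hWp]
  nth_rewrite 1 [hv]
  simp only [metric_sub_left, metric_smul_left]

end ConstantCurvature

end Submfd


/-! ### Polarization of symmetric cubic forms. -/

section Trilinear

/-- A symmetric triadditive form that vanishes on the diagonal vanishes. -/
lemma trilinear_eq_zero {V : Type*} [AddCommGroup V] {T : V → V → V → ℝ}
    (h₁₂ : ∀ x y z, T x y z = T y x z) (h₂₃ : ∀ x y z, T x y z = T x z y)
    (hadd : ∀ x y z z', T x y (z + z') = T x y z + T x y z') (h : ∀ x, T x x x = 0) (x y z : V) :
    T x y z = 0 := by
  have hadd₂ : ∀ x y y' z, T x (y + y') z = T x y z + T x y' z := fun x y y' z => by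
    rw [h₂₃, hadd, h₂₃ x z y, h₂₃ x z y']
  have hadd₁ : ∀ x x' y z, T (x + x') y z = T x y z + T x' y z := fun x x' y z => by
    rw [h₁₂, hadd₂, h₁₂ y x z, h₁₂ y x' z]
  have h1 : ∀ x y, T x x y + T x y y = 0 := by
    intro x y
    have h0 := h (x + y)
    simp only [hadd₁, hadd₂, hadd, h] at h0
    linarith [h₂₃ x x y, h₁₂ x y x, h₁₂ x y y, h₂₃ y x y]
  have h2 : ∀ x y, T x y y = 0 := by
    intro x y
    -- Doubling y separates the degrees: with a = T x x y and b = T x y y, both a + b = 0 and 2a +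
    -- 4b = 0 hold.
    have h0 := h1 x (y + y)
    simp only [hadd₂, hadd] at h0
    linarith [h1 x y]
  have h3 := h2 x (y + z)
  simp only [hadd₂, hadd, h2] at h3
  linarith [h₂₃ x y z]

end Trilinear

section Kaehler

variable {E : Type*} [NormedAddCommGroup E] [NormedSpace ℝ E] [FiniteDimensional ℝ E]
  {N : Type*} [TopologicalSpace N] [ChartedSpace E N] [IsManifold 𝓘(ℝ, E) ∞ N]
  {g : ContMDiffRiemannianMetric 𝓘(ℝ, E) ∞ E (fun x : N => TangentSpace 𝓘(ℝ, E) x)}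
  {cov : CovariantDerivative 𝓘(ℝ, E) E (fun x : N => TangentSpace 𝓘(ℝ, E) x)}
  {J : ∀ x : N, TangentSpace 𝓘(ℝ, E) x →L[ℝ] TangentSpace 𝓘(ℝ, E) x}

lemma IsKaehler.inner_J_left (hK : IsKaehler g cov J) {x : N} (v w : TangentSpace 𝓘(ℝ, E) x) :
    g.inner x (J x v) w = -g.inner x v (J x w) := by
  rw [← hK.J_isometry x v, hK.J_sq, map_neg, neg_neg]

end Kaehler

namespace Submfd

/-! ### Totally real submanifolds with parallel f, and the cubic form. -/

section TotallyReal

variable {F : Type*} [NormedAddCommGroup F] [NormedSpace ℝ F]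
  {M : Type*} [TopologicalSpace M] [ChartedSpace F M]
  {E : Type*} [NormedAddCommGroup E] [NormedSpace ℝ E] [FiniteDimensional ℝ E]
  {N : Type*} [TopologicalSpace N] [ChartedSpace E N] [IsManifold 𝓘(ℝ, E) ∞ N]
  {g : ContMDiffRiemannianMetric 𝓘(ℝ, E) ∞ E (fun x : N => TangentSpace 𝓘(ℝ, E) x)}
  {cov : CovariantDerivative 𝓘(ℝ, E) E (fun x : N => TangentSpace 𝓘(ℝ, E) x)}
  {J : ∀ x : N, TangentSpace 𝓘(ℝ, E) x →L[ℝ] TangentSpace 𝓘(ℝ, E) x}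
  {ι : M → N} {X Y Z U V : ∀ p : M, TangentSpace 𝓘(ℝ, F) p}

variable (g cov J ι) in
/-- The cubic form `(X, Y, Z) ↦ g(σ(X, Y), J Z)` of a submanifold. -/
def cubicForm (X Y : ∀ p : M, TangentSpace 𝓘(ℝ, F) p) (p : M) (v : TangentSpace 𝓘(ℝ, F) p) : ℝ :=
  g.inner (ι p) (sff g cov ι X Y p) (J (ι p) (dι F E ι p v))

lemma cubicForm_add (p : M) (v w : TangentSpace 𝓘(ℝ, F) p) :
    cubicForm g cov J ι X Y p (v + w) =
      cubicForm g cov J ι X Y p v + cubicForm g cov J ι X Y p w := by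
  simp only [cubicForm, map_add]

lemma cubicForm_sub (p : M) (v w : TangentSpace 𝓘(ℝ, F) p) :
    cubicForm g cov J ι X Y p (v - w) =
      cubicForm g cov J ι X Y p v - cubicForm g cov J ι X Y p w := by
  simp only [cubicForm, map_sub]

lemma cubicForm_smul (p : M) (a : ℝ) (v : TangentSpace 𝓘(ℝ, F) p) :
    cubicForm g cov J ι X Y p (a • v) = a * cubicForm g cov J ι X Y p v := by
  simp only [cubicForm, map_smul, smul_eq_mul]

lemma inner_covAlong_eq_cubicForm (hreal : IsTotallyReal F g J ι) (p : M)
    (v : TangentSpace 𝓘(ℝ, F) p) :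
    g.inner (ι p) (covAlong cov ι (fun q => dι F E ι q (Y q)) p (X p)) (J (ι p) (dι F E ι p v)) =
      cubicForm g cov J ι X Y p v := by
  rw [← dι_nabla_add_sff (g := g), map_add, add_apply, g.symm, hreal, zero_add]
  rfl

variable [IsManifold 𝓘(ℝ, F) ∞ M]

lemma cubicForm_comm [FiniteDimensional ℝ F] (hK : IsKaehler g cov J) (hι : IsImmersed F E ι)
    (hX : IsSmoothField X) (hY : IsSmoothField Y) (p : M) (v : TangentSpace 𝓘(ℝ, F) p) :
    cubicForm g cov J ι X Y p v = cubicForm g cov J ι Y X p v := by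
  rw [cubicForm, sff_comm hK.leviCivita hι hX hY, cubicForm]

variable [T2Space N]

/-- Differentiate g(Y, JZ) = 0 along X. As J is parallel and skew, 0 = g(∇̃_X Y, JZ) − g(JY, ∇̃_X
Z), and only the normal parts pair with J(TM). -/
lemma cubicForm_comm_right (hK : IsKaehler g cov J) (hι : IsImmersed F E ι)
    (hreal : IsTotallyReal F g J ι) (hY : IsSmoothField Y) (hZ : IsSmoothField Z) (p : M) :
    cubicForm g cov J ι X Y p (Z p) = cubicForm g cov J ι X Z p (Y p) := by
  have hdZ := hZ.map_dι hι.smooth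
  have h := mvfderiv_inner_along hK.leviCivita (hY.map_dι hι.smooth)
    (hdZ.apply_J hK.smooth_J) (X p)
  have h0 : (fun q => g.inner (ι q) (dι F E ι q (Y q)) (J (ι q) (dι F E ι q (Z q)))) =
      fun _ => (0 : ℝ) := by
    funext q
    rw [g.symm, hreal]
  have h1 : mvfderiv 𝓘(ℝ, F) (fun _ : M => (0 : ℝ)) p (X p) = 0 :=
    congrArg (fun L : F →L[ℝ] ℝ => L (X p)) (mfderiv_const (I := 𝓘(ℝ, F)) (I' := 𝓘(ℝ, ℝ)))
  rw [h0, h1, covAlong_J hK hdZ, inner_covAlong_eq_cubicForm hreal, g.symm, hK.inner_J_left,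
    inner_covAlong_eq_cubicForm hreal] at h
  linarith

/-- A cubic form that vanishes on the diagonal vanishes. -/
lemma cubicForm_eq_zero [FiniteDimensional ℝ F] (hK : IsKaehler g cov J) (hι : IsImmersed F E ι)
    (hreal : IsTotallyReal F g J ι) {p : M}
    (h : ∀ X : ∀ p : M, TangentSpace 𝓘(ℝ, F) p, IsSmoothField X →
      cubicForm g cov J ι X X p (X p) = 0)
    (hX : IsSmoothField X) (hY : IsSmoothField Y) (hZ : IsSmoothField Z) :
    cubicForm g cov J ι X Y p (Z p) = 0 :=
  trilinear_eq_zero (V := smoothFields F M)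
    (T := fun x y z => cubicForm g cov J ι x.1 y.1 p (z.1 p))
    (fun x y _ => cubicForm_comm hK hι x.2 y.2 p _)
    (fun _ y z => cubicForm_comm_right hK hι hreal y.2 z.2 p)
    (fun _ _ _ _ => cubicForm_add p _ _) (fun x => h x.1 x.2) ⟨X, hX⟩ ⟨Y, hY⟩ ⟨Z, hZ⟩

/-- Apply parallelism of f to the normal field JY. Here f(JY) = 0 because J²Y is tangential, while
D_X(JY) = J∇_X Y + ν with ν = fσ(X,Y), so fν = 0. -/
lemma HasParallelF.fOp_sff (hf : HasParallelF F g cov J ι) (hK : IsKaehler g cov J)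
    (hι : IsImmersed F E ι) (hreal : IsTotallyReal F g J ι) (hX : IsSmoothField X)
    (hY : IsSmoothField Y) (p : M) : fOp F g J ι (sff g cov ι X Y) p = 0 := by
  have hdY := hY.map_dι hι.smooth
  have h := hf X (fun q => J (ι q) (dι F E ι q (Y q))) hX (hdY.apply_J hK.smooth_J)
    (fun q v => by rw [g.symm, hreal]) p
  have h0 : fOp F g J ι (fun q => J (ι q) (dι F E ι q (Y q))) = fun _ => 0 := by
    funext q
    rw [fOp, hK.J_sq, ← map_neg, normalPart_dι hι]
  have hn0 : normalPart F g ι p 0 = 0 := normalPart_of_normal hι (by simp)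
  set ν := normalPart F g ι p (J (ι p) (sff g cov ι X Y p)) with hν
  have hD : normalConn g cov ι X (fun q => J (ι q) (dι F E ι q (Y q))) p =
      J (ι p) (dι F E ι p (nabla g cov ι X Y p)) + ν := by
    rw [normalConn, covAlong_J hK hdY, ← dι_nabla_add_sff (g := g), map_add, normalPart_add hι,
      normalPart_of_normal hι fun u => hreal p _ u]
  rw [h0, normalConn, covAlong_zero hι.smooth, hn0, fOp, hD, map_add, hK.J_sq, normalPart_add hι,
    ← map_neg, normalPart_dι hι, zero_add] at h
  -- Since fν = 0, the vector Jν is tangential; hence |ν|² = g(Jσ(X,Y), ν) = −g(σ(X,Y), Jν) = 0.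
  have hJν : J (ι p) ν = dι F E ι p (tangentPart g ι p (J (ι p) ν)) := by
    have := dι_tangentPart_add_normalPart (F := F) g ι p (J (ι p) ν)
    rw [← h, add_zero] at this
    exact this.symm
  refine eq_zero_of_inner_self (g := g) ?_
  change g.inner (ι p) ν ν = 0
  have h1 : g.inner (ι p) (J (ι p) (sff g cov ι X Y p)) ν = g.inner (ι p) ν ν := by
    rw [← dι_tangentPart_add_normalPart (F := F) g ι p (J (ι p) (sff g cov ι X Y p)), map_add,
      add_apply, g.symm, inner_normalPart_dι, zero_add]
  rw [← h1, hK.inner_J_left, hJν]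
  exact neg_eq_zero.2 (inner_normalPart_dι ..)

/-- An equality of fields rather than of values at a point, so that it can be iterated inside
`normalCurv`. -/
lemma HasParallelF.normalConn_J (hf : HasParallelF F g cov J ι) (hK : IsKaehler g cov J)
    (hι : IsImmersed F E ι) (hreal : IsTotallyReal F g J ι) (hX : IsSmoothField X)
    (hY : IsSmoothField Y) :
    normalConn g cov ι X (fun q => J (ι q) (dι F E ι q (Y q))) =
      fun q => J (ι q) (dι F E ι q (nabla g cov ι X Y q)) := by
  funext p
  rw [normalConn, covAlong_J hK (hY.map_dι hι.smooth), ← dι_nabla_add_sff (g := g), map_add,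
    normalPart_add hι, normalPart_of_normal hι fun u => hreal p _ u]
  exact add_eq_left.2 (hf.fOp_sff hK hι hreal hX hY p)

variable [FiniteDimensional ℝ F] [T2Space M]

lemma HasParallelF.normalCurv_J (hf : HasParallelF F g cov J ι) (hK : IsKaehler g cov J)
    (hι : IsImmersed F E ι) (hreal : IsTotallyReal F g J ι) (hX : IsSmoothField X)
    (hY : IsSmoothField Y) (hZ : IsSmoothField Z) (p : M) :
    normalCurv g cov ι X Y (fun q => J (ι q) (dι F E ι q (Z q))) p =
      J (ι p) (dι F E ι p (curv g cov ι X Y Z p)) := by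
  rw [normalCurv, hf.normalConn_J hK hι hreal hX hZ, hf.normalConn_J hK hι hreal hY hZ,
    hf.normalConn_J hK hι hreal (hX.mlieBracket hY) hZ,
    hf.normalConn_J hK hι hreal hX (hY.nabla hK.leviCivita hι hZ),
    hf.normalConn_J hK hι hreal hY (hX.nabla hK.leviCivita hι hZ), curv]
  simp only [map_sub]

/-- If `f` is parallel, then the second fundamental form takes its values in `J(TM)`. -/
lemma HasParallelF.exists_sff_eq (hf : HasParallelF F g cov J ι) (hK : IsKaehler g cov J)
    (hι : IsImmersed F E ι) (hreal : IsTotallyReal F g J ι) (hX : IsSmoothField X)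
    (hY : IsSmoothField Y) :
    ∃ W : ∀ p : M, TangentSpace 𝓘(ℝ, F) p, IsSmoothField W ∧
      (sff g cov ι X Y = fun q => J (ι q) (dι F E ι q (W q))) ∧
      ∀ p v, metric g ι p (W p) v = cubicForm g cov J ι X Y p v := by
  have hσ := (hX.sff hK.leviCivita hι hY).apply_J hK.smooth_J
  -- W is minus the tangential part of Jσ(X,Y). As fσ = 0, this part is all of Jσ(X,Y), and σ =
  -- −J(Jσ).
  refine ⟨_, IsSmoothAlong.neg (ι := (id : M → M)) (hσ.tangentPart (g := g) hι), ?_⟩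
  have h : sff g cov ι X Y = fun q => J (ι q) (dι F E ι q
      (-tangentPart g ι q (J (ι q) (sff g cov ι X Y q)))) := by
    funext q
    have h1 := dι_tangentPart_add_normalPart (F := F) g ι q (J (ι q) (sff g cov ι X Y q))
    rw [show normalPart F g ι q (J (ι q) (sff g cov ι X Y q)) = 0 from
      hf.fOp_sff hK hι hreal hX hY q, add_zero] at h1
    rw [map_neg, h1, map_neg, hK.J_sq, neg_neg]
  refine ⟨h, fun p v => ?_⟩
  refine (hK.J_isometry (ι p) _ _).symm.trans ?_
  rw [← congrFun h p, cubicForm]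

/-- The semiparallelity condition in terms of the cubic form. -/
lemma IsSemiparallel.cubicForm_eq (hsemi : IsSemiparallel F g cov ι)
    (hf : HasParallelF F g cov J ι) (hK : IsKaehler g cov J) (hι : IsImmersed F E ι)
    (hreal : IsTotallyReal F g J ι) {c : ℝ} (hc : HasConstantCurvature F g cov ι c)
    (hX : IsSmoothField X) (hY : IsSmoothField Y) (hZ : IsSmoothField Z) (hU : IsSmoothField U)
    (hV : IsSmoothField V) (p : M) :
    c * (metric g ι p (X p) (V p) * cubicForm g cov J ι Z U p (Y p)
        - metric g ι p (Y p) (V p) * cubicForm g cov J ι Z U p (X p)) =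
      c * (metric g ι p (Y p) (Z p) * cubicForm g cov J ι U V p (X p)
        - metric g ι p (X p) (Z p) * cubicForm g cov J ι U V p (Y p)
        + (metric g ι p (Y p) (U p) * cubicForm g cov J ι Z V p (X p)
        - metric g ι p (X p) (U p) * cubicForm g cov J ι Z V p (Y p))) := by
  have hLC := hK.leviCivita
  obtain ⟨W, hW, hσW, hWC⟩ := hf.exists_sff_eq hK hι hreal hZ hU
  have h := congrArg (fun ν => g.inner (ι p) ν (J (ι p) (dι F E ι p (V p))))
    (hsemi X Y Z U hX hY hZ hU p)
  simp only [map_sub, sub_apply, map_zero, zero_apply] at h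
  have h1 : g.inner (ι p) (normalCurv g cov ι X Y (sff g cov ι Z U) p)
      (J (ι p) (dι F E ι p (V p))) = metric g ι p (curv g cov ι X Y W p) (V p) := by
    rw [hσW, hf.normalCurv_J hK hι hreal hX hY hW, hK.J_isometry, metric]
  have hRZ := hX.curv hLC hι hY hZ
  have hRU := hX.curv hLC hι hY hU
  -- Total symmetry moves the curvature into the last slot of C, which sees only its value at p;
  -- there the pointwise formula `curv_eq` can be substituted.
  have h2 : g.inner (ι p) (sff g cov ι (curv g cov ι X Y Z) U p)
      (J (ι p) (dι F E ι p (V p))) = cubicForm g cov J ι U V p (curv g cov ι X Y Z p) := by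
    rw [← cubicForm_comm_right hK hι hreal hRZ hV, ← cubicForm_comm hK hι hRZ hU, cubicForm]
  have h3 : g.inner (ι p) (sff g cov ι Z (curv g cov ι X Y U) p)
      (J (ι p) (dι F E ι p (V p))) = cubicForm g cov J ι Z V p (curv g cov ι X Y U p) := by
    rw [← cubicForm_comm_right hK hι hreal hRU hV, cubicForm]
  rw [h1, h2, h3, hc.curv_eq hLC hι hX hY hW, hc.curv_eq hLC hι hX hY hZ,
    hc.curv_eq hLC hι hX hY hU] at h
  simp only [metric_smul_left, metric_sub_left, cubicForm_smul, cubicForm_sub] at h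
  rw [metric_comm (Y p) (W p), metric_comm (X p) (W p), hWC, hWC] at h
  linarith

lemma IsSemiparallel.cubicForm_self_eq_zero (hsemi : IsSemiparallel F g cov ι)
    (hf : HasParallelF F g cov J ι) (hK : IsKaehler g cov J) (hι : IsImmersed F E ι)
    (hreal : IsTotallyReal F g J ι) {c : ℝ} (hc : HasConstantCurvature F g cov ι c)
    (hc0 : c ≠ 0) (hF : 1 < Module.finrank ℝ F) (hX : IsSmoothField X) (p : M) :
    cubicForm g cov J ι X X p (X p) = 0 := by
  obtain ⟨w, hw0, hXw⟩ := exists_ne_zero_metric_eq_zero (g := g) (ι := ι) hF p (X p)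
  obtain ⟨Y, hY, rfl⟩ := exists_isSmoothField_eq p w
  have hYX := hXw
  rw [metric_comm] at hYX
  -- At p, with g(X,Y) = 0, `h` reads c|Y|²C(X,X,X) = 2c|X|²C(X,Y,Y) and `h'` reads 3c|Y|²C(Y,Y,X) =
  -- 0. Only Y(p) ≠ 0 matters; X(p) may vanish.
  have h := hsemi.cubicForm_eq hf hK hι hreal hc hX hY hY hX hX p
  have h' := hsemi.cubicForm_eq hf hK hι hreal hc hY hX hY hY hY p
  have hsymm : cubicForm g cov J ι Y X p (Y p) = cubicForm g cov J ι Y Y p (X p) :=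
    cubicForm_comm_right hK hι hreal hX hY p
  have hYY : metric g ι p (Y p) (Y p) ≠ 0 := fun h => hw0 (eq_zero_of_metric_self hι h)
  have hYYX : cubicForm g cov J ι Y Y p (X p) = 0 := by
    rw [hXw] at h'
    have : c * metric g ι p (Y p) (Y p) * cubicForm g cov J ι Y Y p (X p) = 0 := by linarith
    simpa [hc0, hYY] using this
  rw [hYX, hsymm, hYYX, hXw] at h
  have : c * metric g ι p (Y p) (Y p) * cubicForm g cov J ι X X p (X p) = 0 := by linarith
  simpa [hc0, hYY] using this

end TotallyReal

end Submfd

end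

theorem theorem1 {n m : ℕ} (hn : 1 < n)
    {E : Type*} [NormedAddCommGroup E] [NormedSpace ℝ E] [FiniteDimensional ℝ E]
    (hE : Module.finrank ℝ E = 2 * m)
    {N : Type*} [TopologicalSpace N] [T2Space N] [ChartedSpace E N] [IsManifold 𝓘(ℝ, E) ∞ N]
    (g : ContMDiffRiemannianMetric 𝓘(ℝ, E) ∞ E (fun x : N => TangentSpace 𝓘(ℝ, E) x))
    (cov : CovariantDerivative 𝓘(ℝ, E) E (fun x : N => TangentSpace 𝓘(ℝ, E) x))
    (J : ∀ x : N, TangentSpace 𝓘(ℝ, E) x →L[ℝ] TangentSpace 𝓘(ℝ, E) x)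
    (hN : IsKaehler g cov J)
    {F : Type*} [NormedAddCommGroup F] [NormedSpace ℝ F] [FiniteDimensional ℝ F]
    (hF : Module.finrank ℝ F = n)
    {M : Type*} [TopologicalSpace M] [T2Space M] [ChartedSpace F M] [IsManifold 𝓘(ℝ, F) ∞ M]
    (ι : M → N) (hι : Submfd.IsImmersed F E ι)
    (hreal : Submfd.IsTotallyReal F g J ι)
    (hf : Submfd.HasParallelF F g cov J ι)
    (hsemi : Submfd.IsSemiparallel F g cov ι)
    (c : ℝ) (hc : Submfd.HasConstantCurvature F g cov ι c) :
    c = 0 ∨ Submfd.IsTotallyGeodesic F g cov ι := by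
  refine or_iff_not_imp_left.2 fun hc0 X Y hX hY p => ?_
  obtain ⟨W, hW, hσ, hWC⟩ := hf.exists_sff_eq hN hι hreal hX hY
  -- As σ(X,Y) = JW, testing the vanishing cubic form C(X,Y,·) on W itself gives |W|² = 0.
  have hWW : Submfd.metric g ι p (W p) (W p) = 0 := by
    rw [hWC]
    exact Submfd.cubicForm_eq_zero hN hι hreal (fun Z hZ =>
      hsemi.cubicForm_self_eq_zero hf hN hι hreal hc hc0 (by rwa [hF]) hZ p) hX hY hW
  rw [hσ]
  beta_reduce
  rw [Submfd.eq_zero_of_metric_self hι hWW, map_zero, map_zero]
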